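/- Let $d\ge 0$ and $m\ge 1$ be integers and let $\mathcal A$ be a set of subsets of $\{1,\dots,d\}$, each of size at most $m$. On a probability space, let $\theta_{t,i}$ ($t\in\mathbb N$, $1\le i\le d$) be real random variables with $\theta_{t,i}\in[-\tfrac12,\tfrac12]$ almost surely. The outcome of action $a\in\mathcal A$ in period $t$ is $Y_{t,a}=(\theta_{t,i}: i\in a)$ and its reward is $R(Y_{t,a})=\frac1m\sum_{i\in a}\theta_{t,i}$. Let $p^*$ be a random probability distribution such that, conditionally on $p^*$, the vectors $Y_t=(Y_{t,a})_{a\in\mathcal A}$, $t\in\mathbb N$, are i.i.d. with law $p^*$, and let the optimal action $A^*\in\arg\max_{a\in\mathcal A}\mathbb E[R(Y_{t,a})\mid p^*]$ be a measurable function of $p^*$. Let $(U_t)_{t\in\mathbb N}$ be random variables such that each $U_t$ is independent of $\big((U_s)_{s\ne t},(Y_s)_{s\in\mathbb N},p^*\big)$. Let $A_t$ be the action chosen in period $t$, let $\mathcal F_t$ be the $\sigma$-algebra generated by the observations $(A_s,Y_{s,A_s})$, $s<t$, and assume that $A_t$ is measurable with respect to $\sigma(\mathcal F_t,U_t)$.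 The actions are chosen by Thompson sampling: $\mathbb P(A_t=a\mid\mathcal F_t)=\mathbb P(A^*=a\mid\mathcal F_t)$ almost surely for all $t$ and all $a\in\mathcal A$. Assume that, for each $t$, the variables $\theta_{t,1},\dots,\theta_{t,d}$ are independent conditionally on $\mathcal F_t$. For a random variable $Z$ define $$I_t(A^*;Z)=h_t-\mathbb E\Big[-\sum_{a\in\mathcal A}\mathbb P(A^*=a\mid\mathcal F_t,Z)\log\mathbb P(A^*=a\mid\mathcal F_t,Z)\,\Big|\,\mathcal F_t\Big],\qquad h_t=-\sum_{a\in\mathcal A}\mathbb P(A^*=a\mid\mathcal F_t)\log\mathbb P(A^*=a\mid\mathcal F_t),$$ and define the information ratio $$\Gamma_t=\frac{\big(\mathbb E[R(Y_{t,A^*})-R(Y_{t,A_t})\mid\mathcal F_t]\big)^2}{I_t\big(A^*;(A_t,Y_{t,A_t})\big)}\in[0,\infty],$$ where $x/0=\infty$ for $x>0$ and $0/0=0$. Then, for every $t\in\mathbb N$, $$\Gamma_t\le\frac{d}{2m^2}\quad\text{almost surely.}$$ Consequently, for every $T\in\mathbb N$, $$\mathbb E\Big[\sum_{t=1}^{T}\big(R(Y_{t,A^*})-R(Y_{t,A_t})\big)\Big]\le\frac1m\sqrt{d\,H(A^*)\,T},\qquad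 H(A^*)=-\sum_{a\in\mathcal A}\mathbb P(A^*=a)\log\mathbb P(A^*=a).$$ -/

import Mathlib

open MeasureTheory ProbabilityTheory

noncomputable section

namespace Bandit

section Information

/-- Shannon entropy `H(X) = -∑ x, ℙ(X = x) log ℙ(X = x)` (natural logarithm). -/
def entropy {Ω 𝒳 : Type*} [Fintype 𝒳] [MeasurableSpace Ω] (μ : Measure Ω) (X : Ω → 𝒳) : ℝ :=
  ∑ x, Real.negMulLog (μ.real (X ⁻¹' {x}))

/-- The entropy of the posterior law of `X` given the σ-algebra `m`, as a random variable:
`-∑ x, ℙ(X = x | m) log ℙ(X = x | m)`. -/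
def posteriorEntropy {Ω 𝒳 : Type*} [Fintype 𝒳] (m : MeasurableSpace Ω)
    [mΩ : MeasurableSpace Ω] (μ : Measure Ω) (X : Ω → 𝒳) (ω : Ω) : ℝ :=
  ∑ x, Real.negMulLog ((μ⟦X ⁻¹' {x} | m⟧) ω)

/-- The conditional entropy of `X` given `Z` under the posterior measure `ℙ(· | m)`:
`𝔼[-∑ x, ℙ(X = x | m, Z) log ℙ(X = x | m, Z) | m]`. -/
def posteriorCondEntropy {Ω 𝒳 𝒵 : Type*} [Fintype 𝒳] [MeasurableSpace 𝒵]
    (m : MeasurableSpace Ω) [mΩ : MeasurableSpace Ω] (μ : Measure Ω) (X : Ω → 𝒳) (Z : Ω → 𝒵) : Ω → ℝ :=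
  μ[posteriorEntropy (m ⊔ MeasurableSpace.comap Z inferInstance) μ X | m]

/-- The mutual information between `X` and `Z` under the posterior measure `ℙ(· | m)`. -/
def posteriorMutualInfo {Ω 𝒳 𝒵 : Type*} [Fintype 𝒳] [MeasurableSpace 𝒵]
    (m : MeasurableSpace Ω) [mΩ : MeasurableSpace Ω] (μ : Measure Ω) (X : Ω → 𝒳) (Z : Ω → 𝒵) (ω : Ω) : ℝ :=
  posteriorEntropy m μ X ω - posteriorCondEntropy m μ X Z ω

/-- The random variables `f i` are (mutually) independent conditionally on the σ-algebra `m`. -/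
def CondIndepGiven {Ω ι β : Type*} [MeasurableSpace β] (m : MeasurableSpace Ω)
    [mΩ : MeasurableSpace Ω] (μ : Measure Ω) (f : ι → Ω → β) : Prop :=
  ∀ (s : Finset ι) (B : ι → Set β), (∀ i ∈ s, MeasurableSet (B i)) →
    μ⟦⋂ i ∈ s, f i ⁻¹' B i | m⟧ =ᵐ[μ] ∏ i ∈ s, μ⟦f i ⁻¹' B i | m⟧

end Information

section Model

variable {Ω 𝒜 𝒴 𝒰 : Type*} [mΩ : MeasurableSpace Ω] [MeasurableSpace 𝒜] [MeasurableSpace 𝒴]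
  [MeasurableSpace 𝒰]

/-- What the agent sees in period `t`: the chosen action and its outcome, `(A_t, Y_{t,A_t})`. -/
def observation (Y : ℕ → Ω → 𝒜 → 𝒴) (A : ℕ → Ω → 𝒜) (t : ℕ) (ω : Ω) : 𝒜 × 𝒴 :=
  (A t ω, Y t ω (A t ω))

/-- The history `ℱ_t`, generated by the observations made before period `t`
(periods are numbered from `0`, so `ℱ_0` is trivial). -/
abbrev history (Y : ℕ → Ω → 𝒜 → 𝒴) (A : ℕ → Ω → 𝒜) (t : ℕ) : MeasurableSpace Ω :=
  ⨆ s : Fin t, MeasurableSpace.comap (observation Y A s) inferInstance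

/-- The Bayesian online decision problem: `pstar` is the random outcome distribution, `Y t ω a` is
the outcome `Y_{t,a}`, `R` the reward function, `U t` the external randomness of period `t`,
`A t` the action of period `t`, and `Astar` the optimal action. -/
structure IsBanditModel [Fintype 𝒜] (μ : Measure Ω) (pstar : Ω → ProbabilityMeasure (𝒜 → 𝒴))
    (Y : ℕ → Ω → 𝒜 → 𝒴) (R : 𝒴 → ℝ) (U : ℕ → Ω → 𝒰) (A : ℕ → Ω → 𝒜) (Astar : Ω → 𝒜) :
    Prop where
  measurable_pstar : Measurable pstar
  measurable_outcome : ∀ t, Measurable (Y t)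
  measurable_reward : Measurable R
  measurable_noise : ∀ t, Measurable (U t)
  /-- Conditionally on `pstar`, the outcome vectors `Y_t` are i.i.d. with law `pstar`. -/
  iid_outcome : ∀ (s : Finset ℕ) (B : ℕ → Set (𝒜 → 𝒴)), (∀ t ∈ s, MeasurableSet (B t)) →
    μ⟦⋂ t ∈ s, Y t ⁻¹' B t | MeasurableSpace.comap pstar inferInstance⟧
      =ᵐ[μ] fun ω => ∏ t ∈ s, (pstar ω : Measure (𝒜 → 𝒴)).real (B t)
  /-- `U_t` is independent of the other `U_s`, all the outcomes and `pstar`, jointly. -/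
  indep_noise : ∀ t, IndepFun (U t)
    (fun ω => ((fun s : {s : ℕ // s ≠ t} => U s ω), (fun s => Y s ω), pstar ω)) μ
  /-- `A_t` is random only through the history and `U_t`. -/
  measurable_action : ∀ t,
    Measurable[history Y A t ⊔ MeasurableSpace.comap (U t) inferInstance] (A t)
  /-- The optimal action is a function of the outcome distribution ... -/
  measurable_optimal : Measurable[MeasurableSpace.comap pstar inferInstance] Astar
  /-- ... that maximizes the mean reward. -/
  optimal : ∀ᵐ ω ∂μ, ∀ a, ∫ y, R (y a) ∂(pstar ω : Measure (𝒜 → 𝒴))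
    ≤ ∫ y, R (y (Astar ω)) ∂(pstar ω : Measure (𝒜 → 𝒴))

/-- Thompson sampling: given the history, the action has the posterior law of the optimal action. -/
def IsThompsonSampling (μ : Measure Ω) (Y : ℕ → Ω → 𝒜 → 𝒴) (A : ℕ → Ω → 𝒜) (Astar : Ω → 𝒜) :
    Prop :=
  ∀ (t : ℕ) (a : 𝒜), μ⟦A t ⁻¹' {a} | history Y A t⟧ =ᵐ[μ] μ⟦Astar ⁻¹' {a} | history Y A t⟧

/-- The regret incurred in period `t`. -/
def instantRegret (Y : ℕ → Ω → 𝒜 → 𝒴) (R : 𝒴 → ℝ) (A : ℕ → Ω → 𝒜) (Astar : Ω → 𝒜)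
    (t : ℕ) (ω : Ω) : ℝ :=
  R (Y t ω (Astar ω)) - R (Y t ω (A t ω))

/-- The regret over the first `T` periods. -/
def regret (Y : ℕ → Ω → 𝒜 → 𝒴) (R : 𝒴 → ℝ) (A : ℕ → Ω → 𝒜) (Astar : Ω → 𝒜)
    (T : ℕ) (ω : Ω) : ℝ :=
  ∑ t ∈ Finset.range T, instantRegret Y R A Astar t ω

/-- The information ratio `Γ_t`: squared expected regret of period `t` over the information gain
about the optimal action, both under the posterior `ℙ(· | ℱ_t)`. It takes values in `[0, ∞]`,
with `x / 0 = ∞` for `x > 0` and `0 / 0 = 0`. -/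
def informationRatio [Fintype 𝒜] (μ : Measure Ω) (Y : ℕ → Ω → 𝒜 → 𝒴) (R : 𝒴 → ℝ)
    (A : ℕ → Ω → 𝒜) (Astar : Ω → 𝒜) (t : ℕ) (ω : Ω) : ENNReal :=
  ENNReal.ofReal ((μ[instantRegret Y R A Astar t | history Y A t]) ω ^ 2) /
    ENNReal.ofReal
      (posteriorMutualInfo (history Y A t) μ Astar (observation Y A t) ω)

end Model

section SemiBandit

/-- Possible outcomes under semi-bandit feedback: a set of items with a real value for each. -/
abbrev ItemOutcome (d : ℕ) : Type := Σ a : Finset (Fin d), (a → ℝ)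

/-- `Y_{t,a} = (θ_{t,i} : i ∈ a)`. -/
def itemOutcome {Ω : Type*} {d : ℕ} {𝒜 : Finset (Finset (Fin d))} (θ : ℕ → Fin d → Ω → ℝ)
    (t : ℕ) (ω : Ω) (a : 𝒜) : ItemOutcome d :=
  ⟨a.1, fun i => θ t i ω⟩

/-- `R(v_i : i ∈ a) = m⁻¹ ∑_{i ∈ a} v_i`. -/
def itemReward {d : ℕ} (m : ℕ) (y : ItemOutcome d) : ℝ :=
  (1 / (m : ℝ)) * ∑ i, y.2 i

end SemiBandit

end Bandit

end

open Bandit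

/-! Fix a period, let `F` be the history, and write α for the posterior law of A*, which under
Thompson sampling is also the law of A_t. Put u_i = E[θ_i | F], p_i = P(i ∈ A* | F), and c_i = E[θ_i
1{i ∈ A*} | F] - p_i u_i. The noise driving A_t is independent of the environment, so A_t is
conditionally independent of (θ_t, A*) on the relevant items, and E[Σ_{i ∈ A_t} θ_i | F] = Σ p_i
u_i. Up to the factor 1/m, the expected regret is therefore Σ c_i.

The information gain is bounded below by the variational inequality I ≥ Σ_a E[1{A* = a} f_a | F] + 1
- Σ_a α_a E[exp f_a | F] (`le_posteriorMutualInfo`), valid for bounded f_a depending on the history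
and the observation. The test function is f_a = Σ (l_i θ_i - r_i) over i ∈ a ∩ A_t: these items are
observed, so f_a is admissible. Conditional independence of the items and Hoeffding's lemma bound
the exponential moments; taking r_i = l_i u_i + l_i²/8 makes every exponent zero, so the last term
cancels the 1. What remains is Σ_i p_i (l_i c_i - l_i² p_i / 8), maximal at l_i = 4 c_i / p_i,
whence 2 Σ c_i² ≤ I (`two_mul_sum_sq_le_of_forall_tilt`). By Cauchy–Schwarz over the d items, 2 (Σ
c_i)² ≤ d I (`sq_condExp_regret_le`), which is the ratio bound.

For the cumulative bound, the expected information gains telescope to at most H(A*), and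
Cauchy–Schwarz over the periods finishes (`integral_regret_le`). -/

namespace Bandit

/-! ### Posterior entropy and the variational lower bound on mutual information. -/

section Gibbs

/-- The concave function -x log x lies below its tangent line at y. This pointwise Gibbs inequality
is the only source of information-theoretic bounds in the file. -/
theorem negMulLog_le_of_pos {x y : ℝ} (hx : 0 ≤ x) (hy : 0 < y) :
    Real.negMulLog x ≤ -(x * Real.log y) - x + y := by
  rcases hx.eq_or_lt with rfl | hx
  · simpa using hy.le
  have h := Real.log_le_sub_one_of_pos (div_pos hy hx)
  rw [Real.log_div hy.ne' hx.ne'] at h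
  have h2 := mul_le_mul_of_nonneg_left h hx.le
  have h3 : x * (y / x - 1) = y - x := by field_simp
  rw [h3] at h2
  rw [Real.negMulLog]
  linarith

theorem stronglyMeasurable_posteriorEntropy {Ω 𝒳 : Type*} [Fintype 𝒳] {H : MeasurableSpace Ω}
    [mΩ : MeasurableSpace Ω] {μ : Measure Ω} {X : Ω → 𝒳} :
    StronglyMeasurable[H] (posteriorEntropy H μ X) := by
  unfold posteriorEntropy
  exact Finset.stronglyMeasurable_fun_sum _ fun a _ =>
    Real.continuous_negMulLog.comp_stronglyMeasurable stronglyMeasurable_condExp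

variable {Ω 𝒳 : Type*} [Fintype 𝒳] {F H : MeasurableSpace Ω} [mΩ : MeasurableSpace Ω]
  {μ : Measure Ω} [IsProbabilityMeasure μ] {X : Ω → 𝒳}

theorem integrable_of_ae_abs_le {f : Ω → ℝ} (hf : AEStronglyMeasurable f μ) {C : ℝ}
    (hC : ∀ᵐ ω ∂μ, |f ω| ≤ C) : Integrable f μ :=
  Integrable.of_bound hf C hC

theorem condProb_mem_Icc (s : Set Ω) (hs : MeasurableSet s) :
    ∀ᵐ ω ∂μ, (μ⟦s | F⟧) ω ∈ Set.Icc (0 : ℝ) 1 := by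
  by_cases hF : F ≤ mΩ
  swap
  · simp [condExp_of_not_le hF]
  have hint : Integrable (s.indicator (fun _ => (1 : ℝ))) μ := (integrable_const _).indicator hs
  have h0 : (0 : Ω → ℝ) ≤ᵐ[μ] μ[s.indicator (fun _ => (1 : ℝ)) | F] :=
    condExp_nonneg (ae_of_all _ fun ω => Set.indicator_nonneg (fun _ _ => zero_le_one) ω)
  have h1 : μ[s.indicator (fun _ => (1 : ℝ)) | F] ≤ᵐ[μ] μ[fun _ => (1 : ℝ) | F] :=
    condExp_mono hint (integrable_const _)
      (ae_of_all _ fun ω => Set.indicator_le_self' (fun _ _ => zero_le_one) ω)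
  rw [condExp_const hF] at h1
  filter_upwards [h0, h1] with ω a b using ⟨a, b⟩

theorem sum_condProb_eq_one (hF : F ≤ mΩ) (hX : ∀ a, MeasurableSet (X ⁻¹' {a})) :
    ∀ᵐ ω ∂μ, ∑ a, (μ⟦X ⁻¹' {a} | F⟧) ω = 1 := by
  have h := condExp_finsetSum (μ := μ) (s := Finset.univ)
    (f := fun a => (X ⁻¹' {a}).indicator (fun _ => (1 : ℝ)))
    (fun a _ => (integrable_const _).indicator (hX a)) F
  have h1 : (∑ a, (X ⁻¹' {a}).indicator (fun _ => (1 : ℝ))) = fun _ => (1 : ℝ) := by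
    classical
    ext ω
    simp [Finset.sum_apply, Set.indicator_apply]
  rw [h1, condExp_const hF] at h
  filter_upwards [h] with ω hω
  rw [Finset.sum_apply] at hω
  exact hω.symm

/-- Tower property: weighting by a conditional probability or by the event itself is the same. -/
theorem condExp_mul_condProb (hFH : F ≤ H) (hH : H ≤ mΩ) {s : Set Ω} (hs : MeasurableSet s)
    {g : Ω → ℝ} (hg : StronglyMeasurable[H] g) {C : ℝ} (hC : ∀ᵐ ω ∂μ, |g ω| ≤ C) :
    μ[g * μ⟦s | H⟧ | F] =ᵐ[μ] μ[s.indicator g | F] := by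
  have h1 : μ[g * s.indicator (fun _ => (1 : ℝ)) | H] =ᵐ[μ] g * μ⟦s | H⟧ :=
    condExp_stronglyMeasurable_mul_of_bound hH hg ((integrable_const _).indicator hs) C hC
  have h2 : g * s.indicator (fun _ => (1 : ℝ)) = s.indicator g := by
    ext ω; by_cases h : ω ∈ s <;> simp [h]
  rw [h2] at h1
  exact (condExp_congr_ae h1.symm).trans (condExp_condExp_of_le hFH hH)

theorem condExp_mul_condProb_of_measurable (hFH : F ≤ H) (hH : H ≤ mΩ) {s : Set Ω}
    {g : Ω → ℝ} (hg : StronglyMeasurable[F] g) {C : ℝ}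
    (hC : ∀ᵐ ω ∂μ, |g ω| ≤ C) :
    μ[g * μ⟦s | H⟧ | F] =ᵐ[μ] g * μ⟦s | F⟧ := by
  refine (condExp_stronglyMeasurable_mul_of_bound (hFH.trans hH) hg integrable_condExp C hC).trans ?_
  filter_upwards [condExp_condExp_of_le (μ := μ) (f := s.indicator (fun _ => (1 : ℝ))) hFH hH]
    with ω hω
  simp only [Pi.mul_apply, hω]

theorem posteriorEntropy_mem_Icc (hX : ∀ a, MeasurableSet (X ⁻¹' {a})) :
    ∀ᵐ ω ∂μ, posteriorEntropy H μ X ω ∈ Set.Icc (0 : ℝ) (Fintype.card 𝒳) := by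
  filter_upwards [ae_all_iff.2 fun a => condProb_mem_Icc (μ := μ) (F := H) _ (hX a)] with ω h
  constructor
  · exact Finset.sum_nonneg fun a _ => Real.negMulLog_nonneg (h a).1 (h a).2
  · calc posteriorEntropy H μ X ω ≤ ∑ a : 𝒳, (1 : ℝ) := by
          refine Finset.sum_le_sum fun a _ => ?_
          have := negMulLog_le_of_pos (h a).1 one_pos
          have h0 := (h a).1
          simp only [Real.log_one, mul_zero, neg_zero] at this
          linarith
      _ = _ := by simp

theorem integrable_posteriorEntropy (hH : H ≤ mΩ) (hX : ∀ a, MeasurableSet (X ⁻¹' {a})) :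
    Integrable (posteriorEntropy H μ X) μ := by
  refine integrable_of_ae_abs_le (C := Fintype.card 𝒳)
    ((stronglyMeasurable_posteriorEntropy).mono hH).aestronglyMeasurable ?_
  filter_upwards [posteriorEntropy_mem_Icc (μ := μ) (H := H) hX] with ω h
  rw [abs_of_nonneg h.1]
  exact h.2

/-- Apply the tangent-line bound to P(X = a | H) at the point (P(X = a | F) + ε) exp(f_a), sum over
a, and take E[· | F]. The shift by ε keeps the logarithm of the prior probability bounded, so every
term is integrable. -/
theorem condExp_posteriorEntropy_le (hFH : F ≤ H) (hH : H ≤ mΩ)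
    (hX : ∀ a, MeasurableSet (X ⁻¹' {a})) {f : 𝒳 → Ω → ℝ}
    (hf : ∀ a, StronglyMeasurable[H] (f a)) {C : ℝ} (hC : ∀ a, ∀ᵐ ω ∂μ, |f a ω| ≤ C)
    {ε : ℝ} (hε : 0 < ε) :
    ∀ᵐ ω ∂μ, (μ[posteriorEntropy H μ X | F]) ω ≤
      posteriorEntropy F μ X ω - ∑ a, (μ[(X ⁻¹' {a}).indicator (f a) | F]) ω - 1 +
        ∑ a, ((μ⟦X ⁻¹' {a} | F⟧) ω + ε) * (μ[fun ω => Real.exp (f a ω) | F]) ω := by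
  have hF := hFH.trans hH
  set P : 𝒳 → Ω → ℝ := fun a => μ⟦X ⁻¹' {a} | F⟧ with hP
  set Q : 𝒳 → Ω → ℝ := fun a => μ⟦X ⁻¹' {a} | H⟧ with hQ
  set l : 𝒳 → Ω → ℝ := fun a ω => Real.log (max (P a ω) 0 + ε) with hl
  have hPm : ∀ a, StronglyMeasurable[F] (P a) := fun a => stronglyMeasurable_condExp
  have hQm : ∀ a, StronglyMeasurable[H] (Q a) := fun a => stronglyMeasurable_condExp
  have hPI : ∀ᵐ ω ∂μ, ∀ a, P a ω ∈ Set.Icc (0 : ℝ) 1 :=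
    ae_all_iff.2 fun a => condProb_mem_Icc _ (hX a)
  have hQI : ∀ᵐ ω ∂μ, ∀ a, Q a ω ∈ Set.Icc (0 : ℝ) 1 :=
    ae_all_iff.2 fun a => condProb_mem_Icc _ (hX a)
  have hlm : ∀ a, StronglyMeasurable[F] (l a) := fun a =>
    (Real.measurable_log.comp (((hPm a).measurable.max measurable_const).add_const ε)).stronglyMeasurable
  have hlC : ∀ a, ∀ᵐ ω ∂μ, |l a ω| ≤ |Real.log ε| + |Real.log (1 + ε)| := by
    intro a
    filter_upwards [hPI] with ω h
    have h1 := h a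
    simp only [hl, max_eq_left h1.1]
    have e1 : Real.log ε ≤ Real.log (P a ω + ε) := Real.log_le_log hε (by linarith [h1.1])
    have e2 : Real.log (P a ω + ε) ≤ Real.log (1 + ε) :=
      Real.log_le_log (by linarith [h1.1]) (by linarith [h1.2])
    rw [abs_le]
    constructor
    · linarith [neg_abs_le (Real.log ε), abs_nonneg (Real.log (1 + ε))]
    · linarith [le_abs_self (Real.log (1 + ε)), abs_nonneg (Real.log ε)]
  have hfC : ∀ᵐ ω ∂μ, ∀ a, |f a ω| ≤ C := ae_all_iff.2 hC
  have hfi : ∀ a, Integrable (f a * Q a) μ := by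
    intro a
    refine integrable_of_ae_abs_le (C := C) (((hf a).mul (hQm a)).mono hH).aestronglyMeasurable ?_
    filter_upwards [hQI, hfC] with ω h1 h2
    rw [Pi.mul_apply, abs_mul, abs_of_nonneg (h1 a).1]
    exact (mul_le_of_le_one_right (abs_nonneg _) (h1 a).2).trans (h2 a)
  have hli : ∀ a, Integrable (l a * Q a) μ := by
    intro a
    refine integrable_of_ae_abs_le (C := |Real.log ε| + |Real.log (1 + ε)|)
      ((((hlm a).mono hFH).mul (hQm a)).mono hH).aestronglyMeasurable ?_
    filter_upwards [hQI, hlC a] with ω h1 h2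
    rw [Pi.mul_apply, abs_mul, abs_of_nonneg (h1 a).1]
    exact (mul_le_of_le_one_right (abs_nonneg _) (h1 a).2).trans h2
  have hem : ∀ a, StronglyMeasurable[H] (fun ω => Real.exp (f a ω)) := fun a =>
    Real.continuous_exp.comp_stronglyMeasurable (hf a)
  have hei : ∀ a, Integrable (fun ω => Real.exp (f a ω)) μ := by
    intro a
    refine integrable_of_ae_abs_le (C := Real.exp C) ((hem a).mono hH).aestronglyMeasurable ?_
    filter_upwards [hfC] with ω h
    rw [abs_of_pos (Real.exp_pos _)]
    exact Real.exp_le_exp.2 ((le_abs_self _).trans (h a))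
  have hPεm : ∀ a, StronglyMeasurable[F] (fun ω => P a ω + ε) := fun a =>
    (hPm a).add stronglyMeasurable_const
  have hPεC : ∀ a, ∀ᵐ ω ∂μ, ‖P a ω + ε‖ ≤ 1 + ε := by
    intro a
    filter_upwards [hPI] with ω h
    rw [Real.norm_of_nonneg (by linarith [(h a).1])]
    linarith [(h a).2]
  have hPei : ∀ a, Integrable ((fun ω => P a ω + ε) * fun ω => Real.exp (f a ω)) μ := fun a =>
    (hei a).bdd_mul ((hPεm a).mono hF).aestronglyMeasurable (hPεC a)
  have hQi : ∀ a, Integrable (Q a) μ := fun a => integrable_condExp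
  set B : 𝒳 → Ω → ℝ := fun a =>
    ((fun ω => P a ω + ε) * fun ω => Real.exp (f a ω)) - l a * Q a - f a * Q a - Q a with hB
  have hBi : ∀ a, Integrable (B a) μ := fun a =>
    (((hPei a).sub (hli a)).sub (hfi a)).sub (hQi a)
  have hle : posteriorEntropy H μ X ≤ᵐ[μ] ∑ a, B a := by
    filter_upwards [hQI, hPI] with ω h1 h2
    rw [Finset.sum_apply]
    refine Finset.sum_le_sum fun a _ => ?_
    have hpos : 0 < P a ω + ε := by linarith [(h2 a).1]
    have := negMulLog_le_of_pos (h1 a).1 (mul_pos hpos (Real.exp_pos (f a ω)))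
    rw [Real.log_mul hpos.ne' (Real.exp_pos _).ne', Real.log_exp] at this
    simp only [hB, Pi.sub_apply, Pi.mul_apply, hl, max_eq_left (h2 a).1]
    refine this.trans (le_of_eq ?_)
    ring
  have hmono := condExp_mono (m := F) (integrable_posteriorEntropy hH hX)
    (integrable_finsetSum' _ fun a _ => hBi a) hle
  have hsum := condExp_finsetSum (μ := μ) (s := Finset.univ) (f := B) (fun a _ => hBi a) F
  have hBc : ∀ᵐ ω ∂μ, ∀ a, (μ[B a | F]) ω =
      (P a ω + ε) * (μ[fun ω => Real.exp (f a ω) | F]) ω - l a ω * P a ω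
        - (μ[(X ⁻¹' {a}).indicator (f a) | F]) ω - P a ω := by
    refine ae_all_iff.2 fun a => ?_
    filter_upwards [condExp_sub (((hPei a).sub (hli a)).sub (hfi a)) (hQi a) F,
      condExp_sub ((hPei a).sub (hli a)) (hfi a) F, condExp_sub (hPei a) (hli a) F,
      condExp_stronglyMeasurable_mul_of_bound hF (hPεm a) (hei a) _ (hPεC a),
      condExp_mul_condProb_of_measurable (s := X ⁻¹' {a}) hFH hH (hlm a) (hlC a),
      condExp_mul_condProb hFH hH (hX a) (hf a) (hC a),
      condExp_condExp_of_le (μ := μ) (f := (X ⁻¹' {a}).indicator (fun _ => (1 : ℝ))) hFH hH]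
      with ω h1 h2 h3 h4 h5 h6 h7
    simp only [Pi.sub_apply, Pi.mul_apply] at h1 h2 h3 h4 h5
    rw [h1, h2, h3, h4, h5, h6, h7]
  filter_upwards [hmono, hsum, hBc, hPI, sum_condProb_eq_one (μ := μ) hF hX] with ω h1 h2 h3 h4 h5
  rw [h2, Finset.sum_apply] at h1
  simp only [h3, Finset.sum_sub_distrib] at h1
  -- Adding ε inside the logarithm only decreases the entropy; a zero probability contributes zero
  -- on both sides.
  have h6 : -∑ a, l a ω * P a ω ≤ posteriorEntropy F μ X ω := by
    rw [posteriorEntropy, ← Finset.sum_neg_distrib]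
    refine Finset.sum_le_sum fun a _ => ?_
    simp only [hl, max_eq_left (h4 a).1, Real.negMulLog]
    change _ ≤ -P a ω * Real.log (P a ω)
    rcases (h4 a).1.eq_or_lt with h0 | h0
    · simp [← h0]
    · have := mul_le_mul_of_nonneg_right
        (Real.log_le_log h0 (by linarith : P a ω ≤ P a ω + ε)) h0.le
      linarith
  have h7 : ∑ a, P a ω = 1 := h5
  linarith

/-- A Donsker–Varadhan lower bound for the posterior mutual information. -/
theorem le_posteriorMutualInfo {𝒵 : Type*} [MeasurableSpace 𝒵] {Z : Ω → 𝒵} (hF : F ≤ mΩ)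
    (hZ : Measurable Z) (hX : ∀ a, MeasurableSet (X ⁻¹' {a})) {f : 𝒳 → Ω → ℝ}
    (hf : ∀ a, StronglyMeasurable[F ⊔ MeasurableSpace.comap Z inferInstance] (f a))
    {C : ℝ} (hC : ∀ a, ∀ᵐ ω ∂μ, |f a ω| ≤ C) :
    ∀ᵐ ω ∂μ, ∑ a, (μ[(X ⁻¹' {a}).indicator (f a) | F]) ω + 1 -
        ∑ a, (μ⟦X ⁻¹' {a} | F⟧) ω * (μ[fun ω => Real.exp (f a ω) | F]) ω ≤
      posteriorMutualInfo F μ X Z ω := by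
  -- The exceptional null set depends on ε, so ε runs through 1/(n+1) and is then sent to 0.
  have h : ∀ n : ℕ, _ := fun n => condExp_posteriorEntropy_le (μ := μ) (X := X)
    (le_sup_left : F ≤ F ⊔ MeasurableSpace.comap Z inferInstance)
    (sup_le hF hZ.comap_le) hX hf hC (Nat.one_div_pos_of_nat (n := n) (α := ℝ))
  filter_upwards [ae_all_iff.2 h] with ω hω
  rw [posteriorMutualInfo, posteriorCondEntropy]
  set E : 𝒳 → ℝ := fun a => (μ[fun ω => Real.exp (f a ω) | F]) ω
  have hlim : Filter.Tendsto (fun n : ℕ => ∑ a, ((μ⟦X ⁻¹' {a} | F⟧) ω + 1 / ((n : ℝ) + 1)) * E a)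
      Filter.atTop (nhds (∑ a, ((μ⟦X ⁻¹' {a} | F⟧) ω + 0) * E a)) :=
    tendsto_finsetSum _ fun a _ =>
      (tendsto_const_nhds.add tendsto_one_div_add_atTop_nhds_zero_nat).mul_const _
  simp only [add_zero] at hlim
  have := ge_of_tendsto' hlim (fun n => show (μ[posteriorEntropy
      (F ⊔ MeasurableSpace.comap Z inferInstance) μ X | F]) ω - posteriorEntropy F μ X ω +
      ∑ a, (μ[(X ⁻¹' {a}).indicator (f a) | F]) ω + 1 ≤ _ by linarith [hω n])
  linarith

end Gibbs

/-! ### Conditional independence created by external noise. -/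

section CondIndep

variable {Ω : Type*} {F G : MeasurableSpace Ω} [mΩ : MeasurableSpace Ω]
  {μ : Measure Ω} [IsProbabilityMeasure μ]

/-- If `U` is independent of `G`, an event depending on `F ≤ G` and `U` has the same conditional
probability given `G` as given `F`. -/
theorem condProb_eq_of_indep_noise {𝒰 : Type*} [m𝒰 : MeasurableSpace 𝒰] {U : Ω → 𝒰}
    (hU : Measurable U) (hFG : F ≤ G) (hG : G ≤ mΩ)
    (hindep : Indep (MeasurableSpace.comap U m𝒰) G μ) {s : Set Ω}
    (hs : MeasurableSet[F ⊔ MeasurableSpace.comap U m𝒰] s) :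
    μ⟦s | G⟧ =ᵐ[μ] μ⟦s | F⟧ := by
  have hF := hFG.trans hG
  have hsm : MeasurableSet s := (sup_le hF hU.comap_le) s hs
  -- An event of F ⊔ σ(U) is the preimage, under ω ↦ (ω, U ω), of a set in the product of F with the
  -- σ-algebra of U.
  obtain ⟨S, hS, rfl⟩ : ∃ S : Set (Ω × 𝒰), MeasurableSet[F.prod m𝒰] S ∧
      (fun ω => (ω, U ω)) ⁻¹' S = s := by
    have h : F ⊔ MeasurableSpace.comap U m𝒰 =
        MeasurableSpace.comap (fun ω => (ω, U ω)) (F.prod m𝒰) := by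
      rw [MeasurableSpace.prod, MeasurableSpace.comap_sup, MeasurableSpace.comap_comp,
        MeasurableSpace.comap_comp]
      congr 1
      exact MeasurableSpace.comap_id.symm
    rw [h] at hs
    exact hs
  set ν := μ.map U
  have : IsProbabilityMeasure ν := Measure.isProbabilityMeasure_map hU.aemeasurable
  -- The section measure φ is a version of P(s | G) by Fubini, since U is independent of G. It is
  -- already F-measurable, so the tower property identifies it with P(s | F) too.
  set φ : Ω → ℝ := fun ω => ν.real (Prod.mk ω ⁻¹' S) with hφ
  have hφF : StronglyMeasurable[F] φ :=
    (@measurable_measure_prodMk_left Ω 𝒰 F m𝒰 ν _ S hS).ennreal_toReal.stronglyMeasurable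
  have hφi : Integrable φ μ := by
    refine Integrable.of_bound (hφF.mono hF).aestronglyMeasurable 1 (ae_of_all _ fun ω => ?_)
    rw [Real.norm_of_nonneg measureReal_nonneg]
    exact measureReal_le_one
  have hSG : MeasurableSet[G.prod m𝒰] S :=
    (sup_le_sup_right (MeasurableSpace.comap_mono hFG) _) S hS
  have hprod : @Measure.map Ω (Ω × 𝒰) mΩ (G.prod m𝒰) (fun ω => (ω, U ω)) μ =
      @Measure.prod Ω 𝒰 G m𝒰 (μ.trim hG) ν := by
    have := (@indepFun_iff_map_prod_eq_prod_map_map Ω Ω 𝒰 mΩ μ id U G m𝒰 _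
      (@Measurable.aemeasurable Ω Ω mΩ G id μ (measurable_id.mono le_rfl hG)) hU.aemeasurable).1
      (by
        change Indep (MeasurableSpace.comap id G) (MeasurableSpace.comap U m𝒰) μ
        rw [MeasurableSpace.comap_id]
        exact hindep.symm)
    rw [trim_eq_map hG]
    exact this
  have hGc : φ =ᵐ[μ] μ⟦(fun ω => (ω, U ω)) ⁻¹' S | G⟧ := by
    refine ae_eq_condExp_of_forall_setIntegral_eq hG ((integrable_const _).indicator hsm)
      (fun t _ _ => hφi.integrableOn) (fun t ht _ => ?_)
      (hφF.mono hFG).aestronglyMeasurable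
    have htm : MeasurableSet t := hG t ht
    rw [integral_indicator_const _ hsm, smul_eq_mul, mul_one, measureReal_restrict_apply hsm]
    have hmeas : MeasurableSet[G.prod m𝒰] (t ×ˢ Set.univ ∩ S) :=
      (@MeasurableSet.inter _ (G.prod m𝒰) _ _
        (@MeasurableSet.prod Ω 𝒰 G m𝒰 _ _ ht MeasurableSet.univ) hSG)
    have h1 : μ ((fun ω => (ω, U ω)) ⁻¹' S ∩ t) =
        ∫⁻ ω in t, ν (Prod.mk ω ⁻¹' S) ∂μ := by
      have e1 : (fun ω => (ω, U ω)) ⁻¹' S ∩ t = (fun ω => (ω, U ω)) ⁻¹' (t ×ˢ Set.univ ∩ S) := by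
        ext ω; simp [and_comm]
      have hUm : @Measurable Ω (Ω × 𝒰) mΩ (G.prod m𝒰) (fun ω => (ω, U ω)) :=
        @Measurable.prodMk Ω mΩ Ω 𝒰 G m𝒰 _ _ (measurable_id.mono le_rfl hG) hU
      rw [e1, ← @Measure.map_apply Ω (Ω × 𝒰) mΩ (G.prod m𝒰) μ _ hUm _ hmeas, hprod,
        @Measure.prod_apply Ω 𝒰 G m𝒰 (μ.trim hG) ν _ _ hmeas,
        lintegral_trim hG (@measurable_measure_prodMk_left Ω 𝒰 G m𝒰 ν _ _ hmeas),
        ← lintegral_indicator htm]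
      refine lintegral_congr fun ω => ?_
      by_cases h : ω ∈ t <;> simp [h]
    rw [Measure.real, h1, integral_eq_lintegral_of_nonneg_ae
      (ae_of_all _ fun ω => measureReal_nonneg) (hφF.mono hF).aestronglyMeasurable]
    congr 1
    refine lintegral_congr fun ω => ?_
    exact ofReal_measureReal
  have hFc : μ⟦(fun ω => (ω, U ω)) ⁻¹' S | F⟧ =ᵐ[μ] φ := by
    refine (condExp_condExp_of_le hFG hG).symm.trans ((condExp_congr_ae hGc.symm).trans ?_)
    rw [condExp_of_stronglyMeasurable hF hφF hφi]
  exact hGc.symm.trans hFc.symm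

/-- If `s` is conditionally independent of `G` given `F ≤ G`, then conditional expectations of
`G`-measurable variables factor over `s`. -/
theorem condExp_indicator_of_condProb_eq (hFG : F ≤ G) (hG : G ≤ mΩ) {s : Set Ω}
    (hs : MeasurableSet s) (h : μ⟦s | G⟧ =ᵐ[μ] μ⟦s | F⟧) {W : Ω → ℝ}
    (hW : StronglyMeasurable[G] W) {C : ℝ} (hC : ∀ᵐ ω ∂μ, |W ω| ≤ C) :
    μ[s.indicator W | F] =ᵐ[μ] μ⟦s | F⟧ * μ[W | F] := by
  have hWi : Integrable W μ := Integrable.of_bound (hW.mono hG).aestronglyMeasurable C hC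
  have hsi : Integrable (s.indicator (fun _ => (1 : ℝ))) μ := (integrable_const _).indicator hs
  have h1 : s.indicator W = W * s.indicator (fun _ => (1 : ℝ)) := by
    ext ω; by_cases h : ω ∈ s <;> simp [h]
  have h2 : μ[s.indicator W | G] =ᵐ[μ] W * μ⟦s | G⟧ := by
    rw [h1]
    exact condExp_stronglyMeasurable_mul_of_bound hG hW hsi C hC
  have h3 : W * μ⟦s | G⟧ =ᵐ[μ] μ⟦s | F⟧ * W := by
    filter_upwards [h] with ω hω
    simp only [Pi.mul_apply, hω, mul_comm]
  have hb : ∀ᵐ ω ∂μ, ‖(μ⟦s | F⟧) ω‖ ≤ 1 := by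
    refine ae_bdd_abs_condExp_of_ae_bdd_abs (R := 1) (ae_of_all _ fun ω => ?_)
    by_cases h : ω ∈ s <;> simp [h]
  calc μ[s.indicator W | F] =ᵐ[μ] μ[μ[s.indicator W | G] | F] :=
        (condExp_condExp_of_le hFG hG).symm
    _ =ᵐ[μ] μ[μ⟦s | F⟧ * W | F] := condExp_congr_ae (h2.trans h3)
    _ =ᵐ[μ] μ⟦s | F⟧ * μ[W | F] :=
        condExp_stronglyMeasurable_mul_of_bound (hFG.trans hG) stronglyMeasurable_condExp hWi 1 hb

end CondIndep

/-! ### Conditional Hoeffding lemma via regular conditional distributions. -/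

section Hoeffding

variable {Ω ι : Type*} {F : MeasurableSpace Ω} [mΩ : MeasurableSpace Ω]
  {μ : Measure Ω} [IsProbabilityMeasure μ]

/-- Rational half-lines form a π-system generating the Borel sets. With finitely many coordinates
this leaves countably many identities, so they can hold simultaneously for almost every conditional
law. -/
theorem iIndepFun_eval_of_Iic_rat {ν : Measure (ι → ℝ)} [IsProbabilityMeasure ν]
    (h : ∀ (s : Finset ι) (q : ι → ℚ), ν (⋂ i ∈ s, (fun y => y i) ⁻¹' Set.Iic (q i : ℝ)) =
      ∏ i ∈ s, ν ((fun y => y i) ⁻¹' Set.Iic (q i : ℝ))) :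
    iIndepFun (fun i (y : ι → ℝ) => y i) ν := by
  have hgen : ∀ i : ι, MeasurableSpace.comap (fun y : ι → ℝ => y i) inferInstance =
      MeasurableSpace.generateFrom
        (Set.image (Set.preimage fun y : ι → ℝ => y i) (⋃ a : ℚ, {Set.Iic (a : ℝ)})) := by
    intro i
    rw [← MeasurableSpace.comap_generateFrom, ← Real.borel_eq_generateFrom_Iic_rat,
      BorelSpace.measurable_eq (α := ℝ)]
  rw [iIndepFun_iff_iIndep]
  refine iIndepSets.iIndep (fun i => (measurable_pi_apply i).comap_le) _
    (fun i => ?_) hgen ?_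
  · have := Real.isPiSystem_Iic_rat.comap (fun y : ι → ℝ => y i)
    exact this
  · rw [iIndepSets_iff]
    intro s f hf
    have : ∀ i, ∃ q : ℚ, i ∈ s → (fun y : ι → ℝ => y i) ⁻¹' Set.Iic (q : ℝ) = f i := by
      intro i
      by_cases hi : i ∈ s
      · obtain ⟨t, ht, hft⟩ := hf i hi
        simp only [Set.mem_iUnion, Set.mem_singleton_iff] at ht
        obtain ⟨q, rfl⟩ := ht
        exact ⟨q, fun _ => hft⟩
      · exact ⟨0, fun h => absurd h hi⟩
    choose q hq using this
    have h1 := h s q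
    rw [Set.iInter₂_congr hq, Finset.prod_congr rfl fun i hi => by rw [hq i hi]] at h1
    exact h1

/-- Hoeffding's lemma for a product law on a unit cube. -/
theorem integral_exp_sum_le {ν : Measure (ι → ℝ)} [IsProbabilityMeasure ν]
    (hind : iIndepFun (fun i (y : ι → ℝ) => y i) ν)
    (hbdd : ∀ i, ∀ᵐ y ∂ν, y i ∈ Set.Icc (-1 / 2 : ℝ) (1 / 2)) (s : Finset ι) (l : ι → ℝ) :
    ∫ y, Real.exp (∑ i ∈ s, l i * y i) ∂ν ≤
      Real.exp (∑ i ∈ s, (l i * ∫ y, y i ∂ν + l i ^ 2 / 8)) := by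
  have hind' : iIndepFun (fun i (y : ι → ℝ) => l i * y i) ν :=
    hind.comp (fun i x => l i * x) (fun i => measurable_const_mul _)
  have h := hind'.mgf_sum (t := 1)
    (fun i => (measurable_pi_apply i).const_mul _) s
  simp only [mgf, one_mul, Finset.sum_apply] at h
  rw [h, Real.exp_sum]
  refine Finset.prod_le_prod (fun i _ => integral_nonneg fun y => (Real.exp_pos _).le)
    fun i _ => ?_
  -- An interval of length 1 has variance proxy 1/4, which gives the l²/8 in the exponent.
  have hs := (hasSubgaussianMGF_of_mem_Icc (measurable_pi_apply i).aemeasurable (hbdd i)).mgf_le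
    (l i)
  have e : (fun y : ι → ℝ => Real.exp (l i * (y i - ∫ y, y i ∂ν))) = fun y =>
      Real.exp (-(l i * ∫ y, y i ∂ν)) * Real.exp (l i * y i) := by
    ext y
    rw [← Real.exp_add]; ring_nf
  rw [mgf, e, integral_const_mul, Real.exp_neg, inv_mul_le_iff₀ (Real.exp_pos _),
    ← Real.exp_add] at hs
  refine hs.trans (le_of_eq ?_)
  congr 2
  norm_num
  ring

/-- Conditional Hoeffding lemma for conditionally independent variables. -/
theorem condExp_exp_sum_le [Fintype ι] (hF : F ≤ mΩ) {θ : ι → Ω → ℝ} (hθ : ∀ i, Measurable (θ i))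
    (hbdd : ∀ i, ∀ᵐ ω ∂μ, θ i ω ∈ Set.Icc (-1 / 2 : ℝ) (1 / 2))
    (hind : CondIndepGiven F μ θ) (s : Finset ι) (l : ι → ℝ) :
    ∀ᵐ ω ∂μ, (μ[fun ω => Real.exp (∑ i ∈ s, l i * θ i ω) | F]) ω ≤
      Real.exp (∑ i ∈ s, (l i * (μ[θ i | F]) ω + l i ^ 2 / 8)) := by
  set Θ : Ω → ι → ℝ := fun ω i => θ i ω
  have hΘ : Measurable Θ := measurable_pi_lambda _ hθ
  -- Conditioning on the identity map into (Ω, F) gives a regular conditional law given F. Almost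
  -- surely it has independent coordinates lying in the cube, so the unconditional lemma applies for
  -- each such ω.
  set κ := @condDistrib Ω Ω (ι → ℝ) _ _ _ mΩ F Θ id μ _ with hκ
  have hid : @Measurable Ω Ω mΩ F id := measurable_id.mono le_rfl hF
  have hprob : ∀ ω, IsProbabilityMeasure (κ ω) := fun ω => inferInstance
  have hset : ∀ B : Set (ι → ℝ), MeasurableSet B →
      ∀ᵐ ω ∂μ, (κ ω).real B = (μ⟦Θ ⁻¹' B | F⟧) ω := by
    intro B hB
    have := @condDistrib_ae_eq_condExp Ω Ω (ι → ℝ) _ _ _ mΩ μ _ id Θ F B hid hΘ hB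
    rwa [MeasurableSpace.comap_id] at this
  have hfun : ∀ f : (ι → ℝ) → ℝ, StronglyMeasurable f → Integrable (fun ω => f (Θ ω)) μ →
      ∀ᵐ ω ∂μ, (μ[fun ω => f (Θ ω) | F]) ω = ∫ y, f y ∂κ ω := by
    intro f hf hfi
    have := @condExp_ae_eq_integral_condDistrib Ω Ω (ι → ℝ) ℝ _ _ _ _ mΩ μ _ id Θ F _ _ hid
      hΘ.aemeasurable f hf hfi
    rwa [MeasurableSpace.comap_id] at this
  have hpre : ∀ (i : ι) (B : Set ℝ), MeasurableSet B →
      MeasurableSet ((fun y : ι → ℝ => y i) ⁻¹' B) := fun i B hB => measurable_pi_apply i hB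
  have hI : ∀ᵐ ω ∂μ, iIndepFun (fun i (y : ι → ℝ) => y i) (κ ω) := by
    have h : ∀ᵐ ω ∂μ, ∀ (s : Finset ι) (q : ι → ℚ),
        (κ ω).real (⋂ i ∈ s, (fun y => y i) ⁻¹' Set.Iic (q i : ℝ)) =
          ∏ i ∈ s, (κ ω).real ((fun y => y i) ⁻¹' Set.Iic (q i : ℝ)) := by
      refine ae_all_iff.2 fun s => ae_all_iff.2 fun q => ?_
      have h1 := hset (⋂ i ∈ s, (fun y => y i) ⁻¹' Set.Iic (q i : ℝ))
        (Finset.measurableSet_biInter s fun i _ => hpre i _ measurableSet_Iic)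
      have h2 : ∀ᵐ ω ∂μ, ∀ i, (κ ω).real ((fun y => y i) ⁻¹' Set.Iic (q i : ℝ)) =
          (μ⟦θ i ⁻¹' Set.Iic (q i : ℝ) | F⟧) ω :=
        ae_all_iff.2 fun i => hset _ (hpre i _ measurableSet_Iic)
      have h3 := hind s (fun i => Set.Iic (q i : ℝ)) fun _ _ => measurableSet_Iic
      have h4 : Θ ⁻¹' (⋂ i ∈ s, (fun y => y i) ⁻¹' Set.Iic (q i : ℝ)) =
          ⋂ i ∈ s, θ i ⁻¹' Set.Iic (q i : ℝ) := by
        simp only [Set.preimage_iInter]; rfl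
      rw [h4] at h1
      filter_upwards [h1, h2, h3] with ω e1 e2 e3
      rw [e1, e3, Finset.prod_apply]
      exact Finset.prod_congr rfl fun i _ => (e2 i).symm
    filter_upwards [h] with ω hω
    refine iIndepFun_eval_of_Iic_rat fun s q => ?_
    rw [← ENNReal.toReal_eq_toReal_iff' (measure_ne_top _ _)
      (ENNReal.prod_ne_top fun i _ => measure_ne_top _ _), ENNReal.toReal_prod]
    exact hω s q
  have hB : ∀ᵐ ω ∂μ, ∀ i, ∀ᵐ y ∂κ ω, y i ∈ Set.Icc (-1 / 2 : ℝ) (1 / 2) := by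
    refine ae_all_iff.2 fun i => ?_
    have h1 := hset ((fun y => y i) ⁻¹' (Set.Icc (-1 / 2 : ℝ) (1 / 2))ᶜ)
      (hpre i _ measurableSet_Icc.compl)
    have h2 : (Θ ⁻¹' ((fun y => y i) ⁻¹' (Set.Icc (-1 / 2 : ℝ) (1 / 2))ᶜ)).indicator
        (fun _ => (1 : ℝ)) =ᵐ[μ] 0 := by
      filter_upwards [hbdd i] with ω hω
      refine Set.indicator_of_notMem ?_ _
      simpa [Θ] using hω
    have h3 := condExp_congr_ae (m := F) h2
    rw [condExp_zero] at h3
    filter_upwards [h1, h3] with ω e1 e3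
    rw [e3, Pi.zero_apply, measureReal_eq_zero_iff] at e1
    exact e1
  have hm : ∀ᵐ ω ∂μ, ∀ i, (μ[θ i | F]) ω = ∫ y, y i ∂κ ω := by
    refine ae_all_iff.2 fun i => hfun (fun y => y i)
      (measurable_pi_apply i).stronglyMeasurable ?_
    refine Integrable.of_bound (hθ i).aestronglyMeasurable (1 / 2) ?_
    filter_upwards [hbdd i] with ω hω
    rw [Real.norm_eq_abs, abs_le]
    exact ⟨by linarith [hω.1], hω.2⟩
  have he := hfun (fun y => Real.exp (∑ i ∈ s, l i * y i))
    (Continuous.stronglyMeasurable (by fun_prop)) (by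
      refine Integrable.of_bound (C := Real.exp (∑ i ∈ s, |l i|)) ?_ ?_
      · refine Measurable.aestronglyMeasurable ?_
        exact Real.measurable_exp.comp (Finset.measurable_fun_sum _ fun i _ => (hθ i).const_mul _)
      · filter_upwards [ae_all_iff.2 hbdd] with ω hω
        rw [Real.norm_of_nonneg (Real.exp_pos _).le]
        refine Real.exp_le_exp.2 (Finset.sum_le_sum fun i _ => ?_)
        refine (le_abs_self _).trans ?_
        rw [abs_mul]
        refine mul_le_of_le_one_right (abs_nonneg _) ?_
        rw [abs_le]
        exact ⟨by linarith [(hω i).1], by linarith [(hω i).2]⟩)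
  filter_upwards [hI, hB, hm, he] with ω e1 e2 e3 e4
  refine (le_of_eq e4).trans ((integral_exp_sum_le e1 e2 s l).trans (le_of_eq ?_))
  simp only [e3]

end Hoeffding

/-! ### Regret against information gain in a single period. -/

section OneStep

/-- Membership in an intersection is a product of two memberships, so after exchanging sums each
item contributes a product of a b-sum and an a-sum. -/
theorem sum_sum_inter_mul {𝒳 ι : Type*} [Fintype 𝒳] [Fintype ι] [DecidableEq ι]
    (S : 𝒳 → Finset ι) (α : 𝒳 → ℝ) (x : 𝒳 → ι → ℝ) :
    ∑ a, ∑ b, α b * ∑ i ∈ S a ∩ S b, x a i =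
      ∑ i, (∑ b, if i ∈ S b then α b else 0) * ∑ a, if i ∈ S a then x a i else 0 := by
  have h : ∀ a b, α b * ∑ i ∈ S a ∩ S b, x a i =
      ∑ i, (if i ∈ S b then α b else 0) * if i ∈ S a then x a i else 0 := by
    intro a b
    rw [Finset.mul_sum, ← Finset.sum_subset (Finset.subset_univ (S a ∩ S b))]
    · refine Finset.sum_congr rfl fun i hi => ?_
      rw [Finset.mem_inter] at hi
      simp [hi.1, hi.2]
    · intro i _ hi
      rw [Finset.mem_inter, not_and_or] at hi
      rcases hi with hi | hi <;> simp [hi]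
  simp only [h, Finset.sum_mul_sum]
  rw [Finset.sum_comm_cycle]
  refine Finset.sum_congr rfl fun i _ => ?_
  rw [Finset.sum_comm]

/-- Optimizing the exponential tilt turns the family of lower bounds into a quadratic one. -/
theorem two_mul_sum_sq_le_of_forall_tilt {𝒳 ι : Type*} [Fintype 𝒳] [Fintype ι] [DecidableEq ι]
    (S : 𝒳 → Finset ι) {α : 𝒳 → ℝ} {e : 𝒳 → ι → ℝ} {u : ι → ℝ} {I : ℝ}
    (hα : ∀ a, 0 ≤ α a) (hα1 : ∑ a, α a = 1) (he : ∀ a i, |e a i| ≤ α a)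
    (h : ∀ l r : ι → ℝ,
      ∑ a, ∑ b, α b * ∑ i ∈ S a ∩ S b, (l i * e a i - r i * α a) + 1 -
        ∑ a, α a * ∑ b, α b *
          Real.exp (∑ i ∈ S a ∩ S b, (l i * u i + l i ^ 2 / 8 - r i)) ≤ I) :
    2 * ∑ i, ((∑ a, if i ∈ S a then e a i else 0) -
      (∑ a, if i ∈ S a then α a else 0) * u i) ^ 2 ≤ I := by
  set p : ι → ℝ := fun i => ∑ a, if i ∈ S a then α a else 0 with hp
  set E : ι → ℝ := fun i => ∑ a, if i ∈ S a then e a i else 0 with hE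
  set c : ι → ℝ := fun i => E i - p i * u i with hc
  -- Needed because the optimal tilt divides by p_i: an item that is almost never optimal has c_i =
  -- 0 and contributes nothing.
  have hcp : ∀ i, p i = 0 → c i = 0 := by
    intro i hi
    have h0 : ∀ a, (if i ∈ S a then α a else 0) = 0 := by
      have := (Finset.sum_eq_zero_iff_of_nonneg (s := Finset.univ)
        (f := fun a => if i ∈ S a then α a else 0)
        (fun a _ => by split_ifs <;> simp [hα a])).1 hi
      exact fun a => this a (Finset.mem_univ a)
    have hE0 : E i = 0 := by
      refine Finset.sum_eq_zero fun a _ => ?_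
      have h1 := h0 a
      split_ifs at h1 ⊢ with hm
      · exact abs_nonpos_iff.1 ((he a i).trans h1.le)
      · rfl
    simp [hc, hE0, hi]
  -- Maximizer of l c_i - l² p_i / 8. The matching choice of r in the next line makes every exponent
  -- vanish.
  set l : ι → ℝ := fun i => 4 * c i / p i with hl
  have key := h l (fun i => l i * u i + l i ^ 2 / 8)
  rw [sum_sum_inter_mul] at key
  simp only [sub_self, Finset.sum_const_zero, Real.exp_zero, mul_one, hα1] at key
  rw [add_sub_cancel_right] at key
  refine le_trans (le_of_eq ?_) key
  rw [Finset.mul_sum]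
  refine Finset.sum_congr rfl fun i _ => ?_
  have h1 : (∑ a, if i ∈ S a then l i * e a i - (l i * u i + l i ^ 2 / 8) * α a else 0) =
      l i * E i - (l i * u i + l i ^ 2 / 8) * p i := by
    rw [hE, hp, Finset.mul_sum, Finset.mul_sum, ← Finset.sum_sub_distrib]
    refine Finset.sum_congr rfl fun a _ => ?_
    split_ifs <;> simp
  rw [h1]
  change 2 * c i ^ 2 = p i * _
  by_cases hi : p i = 0
  · simp [hi, hcp i hi]
  · have h2 : l i * E i - (l i * u i + l i ^ 2 / 8) * p i = l i * c i - l i ^ 2 / 8 * p i := by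
      simp only [hc]; ring
    rw [h2, hl]
    field_simp
    ring

theorem comp_eq_sum_indicator {Ω 𝒳 : Type*} [Fintype 𝒳] (A : Ω → 𝒳) (W : 𝒳 → Ω → ℝ) :
    (fun ω => W (A ω) ω) = ∑ b, (A ⁻¹' {b}).indicator (W b) := by
  classical
  ext ω
  simp [Finset.sum_apply, Set.indicator_apply]

variable {Ω 𝒳 : Type*} [Fintype 𝒳] {F G : MeasurableSpace Ω} [mΩ : MeasurableSpace Ω]
  {μ : Measure Ω}

theorem integrable_comp {A : Ω → 𝒳} (hA : ∀ b, MeasurableSet (A ⁻¹' {b})) {W : 𝒳 → Ω → ℝ}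
    (hW : ∀ b, Integrable (W b) μ) : Integrable (fun ω => W (A ω) ω) μ := by
  rw [comp_eq_sum_indicator]
  exact integrable_finsetSum' _ fun b _ => (hW b).indicator (hA b)

theorem condExp_comp_eq_sum {A : Ω → 𝒳} (hA : ∀ b, MeasurableSet (A ⁻¹' {b})) {W : 𝒳 → Ω → ℝ}
    (hW : ∀ b, Integrable (W b) μ) :
    ∀ᵐ ω ∂μ, (μ[fun ω => W (A ω) ω | F]) ω =
      ∑ b, (μ[(A ⁻¹' {b}).indicator (W b) | F]) ω := by
  rw [comp_eq_sum_indicator]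
  filter_upwards [condExp_finsetSum (μ := μ) (s := Finset.univ)
    (f := fun b => (A ⁻¹' {b}).indicator (W b)) (fun b _ => (hW b).indicator (hA b)) F] with ω h
  rw [h, Finset.sum_apply]

variable [IsProbabilityMeasure μ]

/-- Conditional expectation of a quantity evaluated at an action which is conditionally independent
of `G` given `F`. -/
theorem condExp_comp_action (hFG : F ≤ G) (hG : G ≤ mΩ) {A : Ω → 𝒳}
    (hA : ∀ b, MeasurableSet (A ⁻¹' {b}))
    (hAG : ∀ b, μ⟦A ⁻¹' {b} | G⟧ =ᵐ[μ] μ⟦A ⁻¹' {b} | F⟧) {W : 𝒳 → Ω → ℝ}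
    (hW : ∀ b, StronglyMeasurable[G] (W b)) {C : ℝ} (hC : ∀ b, ∀ᵐ ω ∂μ, |W b ω| ≤ C) :
    ∀ᵐ ω ∂μ, (μ[fun ω => W (A ω) ω | F]) ω =
      ∑ b, (μ⟦A ⁻¹' {b} | F⟧) ω * (μ[W b | F]) ω := by
  have hWi : ∀ b, Integrable (W b) μ := fun b =>
    Integrable.of_bound ((hW b).mono hG).aestronglyMeasurable C (hC b)
  filter_upwards [condExp_comp_eq_sum (F := F) hA hWi,
    ae_all_iff.2 fun b => condExp_indicator_of_condProb_eq hFG hG (hA b) (hAG b) (hW b) (hC b)]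
    with ω h1 h2
  rw [h1]
  exact Finset.sum_congr rfl fun b _ => h2 b

theorem abs_sum_le_of_mem_Icc {ι : Type*} [Fintype ι] {x : ι → ℝ}
    (hx : ∀ i, x i ∈ Set.Icc (-1 / 2 : ℝ) (1 / 2)) (s : Finset ι) (l r : ι → ℝ) :
    |∑ i ∈ s, (l i * x i - r i)| ≤ ∑ i, (|l i| + |r i|) := by
  calc |∑ i ∈ s, (l i * x i - r i)| ≤ ∑ i ∈ s, |l i * x i - r i| := Finset.abs_sum_le_sum_abs _ _
    _ ≤ ∑ i ∈ s, (|l i| + |r i|) := by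
        refine Finset.sum_le_sum fun i _ => (abs_sub _ _).trans ?_
        rw [abs_mul]
        have : |x i| ≤ 1 := abs_le.2 ⟨by linarith [(hx i).1], by linarith [(hx i).2]⟩
        gcongr
        exact mul_le_of_le_one_right (abs_nonneg _) this
    _ ≤ _ := Finset.sum_le_sum_of_subset_of_nonneg (Finset.subset_univ _)
        fun i _ _ => by positivity

variable {ι : Type*} [Fintype ι] [DecidableEq ι] {S : 𝒳 → Finset ι} {θ : ι → Ω → ℝ}
  {A Astar : Ω → 𝒳}

/-- The variational bound for the test functions Σ (l_i θ_i - r_i) over i ∈ S a ∩ S A. Restricting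
to S A makes them observable; averaging over A with weights from Thompson sampling produces the
double sums, and Hoeffding bounds the exponential terms. -/
theorem tilted_le_posteriorMutualInfo {𝒵 : Type*} [MeasurableSpace 𝒵] {Z : Ω → 𝒵}
    (hFG : F ≤ G) (hG : G ≤ mΩ) (hZ : Measurable Z)
    (hθ : ∀ i, Measurable (θ i)) (hbdd : ∀ i, ∀ᵐ ω ∂μ, θ i ω ∈ Set.Icc (-1 / 2 : ℝ) (1 / 2))
    (hind : CondIndepGiven F μ θ) (hA : ∀ b, MeasurableSet (A ⁻¹' {b}))
    (hAG : ∀ b, μ⟦A ⁻¹' {b} | G⟧ =ᵐ[μ] μ⟦A ⁻¹' {b} | F⟧)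
    (hTS : ∀ b, μ⟦A ⁻¹' {b} | F⟧ =ᵐ[μ] μ⟦Astar ⁻¹' {b} | F⟧)
    (hAstar : ∀ b, MeasurableSet[G] (Astar ⁻¹' {b}))
    (hθG : ∀ b, ∀ i ∈ S b, Measurable[G] (θ i))
    (hAZ : ∀ b, MeasurableSet[MeasurableSpace.comap Z inferInstance] (A ⁻¹' {b}))
    (hθZ : ∀ i, Measurable[MeasurableSpace.comap Z inferInstance]
      (fun ω => if i ∈ S (A ω) then θ i ω else 0)) (l r : ι → ℝ) :
    ∀ᵐ ω ∂μ,
      ∑ a, ∑ b, (μ⟦Astar ⁻¹' {b} | F⟧) ω * ∑ i ∈ S a ∩ S b,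
        (l i * (μ[(Astar ⁻¹' {a}).indicator (θ i) | F]) ω - r i * (μ⟦Astar ⁻¹' {a} | F⟧) ω) + 1 -
      ∑ a, (μ⟦Astar ⁻¹' {a} | F⟧) ω * ∑ b, (μ⟦Astar ⁻¹' {b} | F⟧) ω *
        Real.exp (∑ i ∈ S a ∩ S b, (l i * (μ[θ i | F]) ω + l i ^ 2 / 8 - r i)) ≤
      posteriorMutualInfo F μ Astar Z ω := by
  have hF := hFG.trans hG
  have hX : ∀ a, MeasurableSet (Astar ⁻¹' {a}) := fun a => hG _ (hAstar a)
  have hbdd' := ae_all_iff.2 hbdd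
  set C : ℝ := ∑ i, (|l i| + |r i|) with hCdef
  set w : 𝒳 → 𝒳 → Ω → ℝ := fun a b ω => ∑ i ∈ S a ∩ S b, (l i * θ i ω - r i) with hw
  have hwC : ∀ᵐ ω ∂μ, ∀ a b, |w a b ω| ≤ C := by
    filter_upwards [hbdd'] with ω h a b
    exact abs_sum_le_of_mem_Icc h _ _ _
  have hwG : ∀ a b, StronglyMeasurable[G] (w a b) := by
    intro a b
    refine Finset.stronglyMeasurable_fun_sum _ fun i hi => ?_
    exact (((hθG b i (Finset.mem_inter.1 hi).2).stronglyMeasurable).const_mul _).sub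
      stronglyMeasurable_const
  have hθi : ∀ i, Integrable (θ i) μ := by
    intro i
    refine integrable_of_ae_abs_le (C := 1) (hθ i).aestronglyMeasurable ?_
    filter_upwards [hbdd i] with ω h
    exact abs_le.2 ⟨by linarith [h.1], by linarith [h.2]⟩
  have hf : ∀ a, StronglyMeasurable[F ⊔ MeasurableSpace.comap Z inferInstance]
      (fun ω => w a (A ω) ω) := by
    intro a
    refine StronglyMeasurable.mono ?_ (le_sup_right : MeasurableSpace.comap Z inferInstance ≤ _)
    -- The sum is rewritten over the fixed set S a with unseen items replaced by 0, which exhibits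
    -- it as a function of the observation Z.
    have e : (fun ω => w a (A ω) ω) = fun ω => ∑ i ∈ S a,
        (l i * (if i ∈ S (A ω) then θ i ω else 0) -
          ∑ b, (A ⁻¹' {b}).indicator (fun _ => if i ∈ S b then r i else 0) ω) := by
      ext ω
      have : ∀ i, ∑ b, (A ⁻¹' {b}).indicator (fun _ => if i ∈ S b then r i else 0) ω =
          if i ∈ S (A ω) then r i else 0 := by
        intro i
        have := congrFun (comp_eq_sum_indicator A fun b _ => if i ∈ S b then r i else 0) ω
        rw [Finset.sum_apply] at this
        exact this.symm
      simp only [hw, this, ← Finset.filter_mem_eq_inter, Finset.sum_filter]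
      refine Finset.sum_congr rfl fun i _ => ?_
      split_ifs <;> simp
    rw [e]
    refine Finset.stronglyMeasurable_fun_sum _ fun i _ => ?_
    refine ((hθZ i).stronglyMeasurable.const_mul _).sub ?_
    exact Finset.stronglyMeasurable_fun_sum _ fun b _ =>
      stronglyMeasurable_const.indicator (hAZ b)
  have hDV := le_posteriorMutualInfo (μ := μ) hF hZ hX hf (C := C)
    (fun a => by filter_upwards [hwC] with ω h using h a _)
  have h1 : ∀ᵐ ω ∂μ, ∀ a, (μ[(Astar ⁻¹' {a}).indicator (fun ω => w a (A ω) ω) | F]) ω =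
      ∑ b, (μ⟦A ⁻¹' {b} | F⟧) ω * (μ[(Astar ⁻¹' {a}).indicator (w a b) | F]) ω := by
    refine ae_all_iff.2 fun a => ?_
    have := condExp_comp_action (W := fun b => (Astar ⁻¹' {a}).indicator (w a b)) (C := C)
      hFG hG hA hAG (fun b => (hwG a b).indicator (hAstar a)) (fun b => by
        filter_upwards [hwC] with ω h
        by_cases hm : ω ∈ Astar ⁻¹' {a}
        · simpa [hm] using h a b
        · simpa [hm] using (abs_nonneg _).trans (h a b))
    exact this
  have h2 : ∀ᵐ ω ∂μ, ∀ a b, (μ[(Astar ⁻¹' {a}).indicator (w a b) | F]) ω =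
      ∑ i ∈ S a ∩ S b, (l i * (μ[(Astar ⁻¹' {a}).indicator (θ i) | F]) ω -
        r i * (μ⟦Astar ⁻¹' {a} | F⟧) ω) := by
    refine ae_all_iff.2 fun a => ae_all_iff.2 fun b => ?_
    have e : (Astar ⁻¹' {a}).indicator (w a b) = ∑ i ∈ S a ∩ S b,
        (l i • (Astar ⁻¹' {a}).indicator (θ i) -
          r i • (Astar ⁻¹' {a}).indicator (fun _ => (1 : ℝ))) := by
      ext ω
      by_cases hm : ω ∈ Astar ⁻¹' {a} <;> simp [hw, hm, Finset.sum_apply]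
    rw [e]
    have i1 : ∀ i, Integrable (l i • (Astar ⁻¹' {a}).indicator (θ i)) μ := fun i =>
      ((hθi i).indicator (hX a)).smul _
    have i2 : ∀ i, Integrable (r i • (Astar ⁻¹' {a}).indicator (fun _ => (1 : ℝ))) μ := fun i =>
      ((integrable_const _).indicator (hX a)).smul _
    filter_upwards [condExp_finsetSum (μ := μ) (fun i (_ : i ∈ S a ∩ S b) => (i1 i).sub (i2 i)) F,
      ae_all_iff.2 fun i => condExp_sub (i1 i) (i2 i) F,
      ae_all_iff.2 fun i => condExp_smul (μ := μ) (l i) ((Astar ⁻¹' {a}).indicator (θ i)) F,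
      ae_all_iff.2 fun i => condExp_smul (μ := μ) (r i)
        ((Astar ⁻¹' {a}).indicator (fun _ => (1 : ℝ))) F] with ω e1 e2 e3 e4
    rw [e1, Finset.sum_apply]
    refine Finset.sum_congr rfl fun i _ => ?_
    rw [e2 i, Pi.sub_apply, e3 i, e4 i, Pi.smul_apply, Pi.smul_apply, smul_eq_mul, smul_eq_mul]
  have h3 : ∀ᵐ ω ∂μ, ∀ a, (μ[fun ω => Real.exp (w a (A ω) ω) | F]) ω =
      ∑ b, (μ⟦A ⁻¹' {b} | F⟧) ω * (μ[fun ω => Real.exp (w a b ω) | F]) ω := by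
    refine ae_all_iff.2 fun a => ?_
    refine condExp_comp_action (W := fun b ω => Real.exp (w a b ω)) (C := Real.exp C)
      hFG hG hA hAG (fun b => Real.continuous_exp.comp_stronglyMeasurable (hwG a b)) (fun b => ?_)
    filter_upwards [hwC] with ω h
    rw [abs_of_pos (Real.exp_pos _)]
    exact Real.exp_le_exp.2 ((le_abs_self _).trans (h a b))
  have h4 : ∀ᵐ ω ∂μ, ∀ a b, (μ[fun ω => Real.exp (w a b ω) | F]) ω ≤
      Real.exp (∑ i ∈ S a ∩ S b, (l i * (μ[θ i | F]) ω + l i ^ 2 / 8 - r i)) := by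
    refine ae_all_iff.2 fun a => ae_all_iff.2 fun b => ?_
    have e : (fun ω => Real.exp (w a b ω)) = Real.exp (-∑ i ∈ S a ∩ S b, r i) •
        fun ω => Real.exp (∑ i ∈ S a ∩ S b, l i * θ i ω) := by
      ext ω
      rw [Pi.smul_apply, smul_eq_mul, ← Real.exp_add]
      simp only [hw, Finset.sum_sub_distrib]
      ring_nf
    rw [e]
    filter_upwards [condExp_smul (μ := μ) (Real.exp (-∑ i ∈ S a ∩ S b, r i))
      (fun ω => Real.exp (∑ i ∈ S a ∩ S b, l i * θ i ω)) F,
      condExp_exp_sum_le hF hθ hbdd hind (S a ∩ S b) l] with ω e1 e2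
    rw [e1, Pi.smul_apply, smul_eq_mul]
    refine (mul_le_mul_of_nonneg_left e2 (Real.exp_pos _).le).trans (le_of_eq ?_)
    rw [← Real.exp_add, Finset.sum_sub_distrib]
    ring_nf
  filter_upwards [hDV, h1, h2, h3, h4, ae_all_iff.2 hTS,
    ae_all_iff.2 fun a => condProb_mem_Icc (μ := μ) (F := F) _ (hX a)] with ω e0 e1 e2 e3 e4 e5 e6
  refine le_trans ?_ e0
  have : ∑ a, (μ⟦Astar ⁻¹' {a} | F⟧) ω * (μ[fun ω => Real.exp (w a (A ω) ω) | F]) ω ≤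
      ∑ a, (μ⟦Astar ⁻¹' {a} | F⟧) ω * ∑ b, (μ⟦Astar ⁻¹' {b} | F⟧) ω *
        Real.exp (∑ i ∈ S a ∩ S b, (l i * (μ[θ i | F]) ω + l i ^ 2 / 8 - r i)) := by
    refine Finset.sum_le_sum fun a _ => mul_le_mul_of_nonneg_left ?_ (e6 a).1
    rw [e3 a]
    refine Finset.sum_le_sum fun b _ => ?_
    rw [e5 b]
    exact mul_le_mul_of_nonneg_left (e4 a b) (e6 b).1
  refine sub_le_sub (le_of_eq ?_) this
  congr 1
  refine Finset.sum_congr rfl fun a _ => ?_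
  rw [e1 a]
  refine Finset.sum_congr rfl fun b _ => ?_
  rw [e2 a b, e5 b]

/-- One period of Thompson sampling with semi-bandit feedback and conditionally independent
items: the squared expected regret is at most a multiple of the information gain. -/
theorem sq_condExp_regret_le {𝒵 : Type*} [MeasurableSpace 𝒵] {Z : Ω → 𝒵}
    (hFG : F ≤ G) (hG : G ≤ mΩ) (hZ : Measurable Z)
    (hθ : ∀ i, Measurable (θ i)) (hbdd : ∀ i, ∀ᵐ ω ∂μ, θ i ω ∈ Set.Icc (-1 / 2 : ℝ) (1 / 2))
    (hind : CondIndepGiven F μ θ) (hA : ∀ b, MeasurableSet (A ⁻¹' {b}))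
    (hAG : ∀ b, μ⟦A ⁻¹' {b} | G⟧ =ᵐ[μ] μ⟦A ⁻¹' {b} | F⟧)
    (hTS : ∀ b, μ⟦A ⁻¹' {b} | F⟧ =ᵐ[μ] μ⟦Astar ⁻¹' {b} | F⟧)
    (hAstar : ∀ b, MeasurableSet[G] (Astar ⁻¹' {b}))
    (hθG : ∀ b, ∀ i ∈ S b, Measurable[G] (θ i))
    (hAZ : ∀ b, MeasurableSet[MeasurableSpace.comap Z inferInstance] (A ⁻¹' {b}))
    (hθZ : ∀ i, Measurable[MeasurableSpace.comap Z inferInstance]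
      (fun ω => if i ∈ S (A ω) then θ i ω else 0)) :
    ∀ᵐ ω ∂μ, 2 * (μ[fun ω => ∑ i ∈ S (Astar ω), θ i ω - ∑ i ∈ S (A ω), θ i ω | F]) ω ^ 2 ≤
      Fintype.card ι * posteriorMutualInfo F μ Astar Z ω := by
  have hF := hFG.trans hG
  have hX : ∀ a, MeasurableSet (Astar ⁻¹' {a}) := fun a => hG _ (hAstar a)
  have hbdd' := ae_all_iff.2 hbdd
  have hθC : ∀ i, ∀ᵐ ω ∂μ, |θ i ω| ≤ 1 := by
    intro i
    filter_upwards [hbdd i] with ω h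
    exact abs_le.2 ⟨by linarith [h.1], by linarith [h.2]⟩
  have hθi : ∀ i, Integrable (θ i) μ := fun i =>
    integrable_of_ae_abs_le (hθ i).aestronglyMeasurable (hθC i)
  have htilt : ∀ᵐ ω ∂μ, ∀ l r : ι → ℝ,
      ∑ a, ∑ b, (μ⟦Astar ⁻¹' {b} | F⟧) ω * ∑ i ∈ S a ∩ S b,
        (l i * (μ[(Astar ⁻¹' {a}).indicator (θ i) | F]) ω - r i * (μ⟦Astar ⁻¹' {a} | F⟧) ω) + 1 -
      ∑ a, (μ⟦Astar ⁻¹' {a} | F⟧) ω * ∑ b, (μ⟦Astar ⁻¹' {b} | F⟧) ω *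
        Real.exp (∑ i ∈ S a ∩ S b, (l i * (μ[θ i | F]) ω + l i ^ 2 / 8 - r i)) ≤
      posteriorMutualInfo F μ Astar Z ω := by
    -- The optimal tilt depends on ω, so one null set must serve all (l, r): a countable dense
    -- family is used, then continuity.
    have h : ∀ n : ℕ, _ := fun n => tilted_le_posteriorMutualInfo (S := S) hFG hG hZ hθ hbdd hind
      hA hAG hTS hAstar hθG hAZ hθZ
      (TopologicalSpace.denseSeq ((ι → ℝ) × (ι → ℝ)) n).1
      (TopologicalSpace.denseSeq ((ι → ℝ) × (ι → ℝ)) n).2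
    filter_upwards [ae_all_iff.2 h] with ω hω l r
    refine (TopologicalSpace.denseRange_denseSeq ((ι → ℝ) × (ι → ℝ))).induction_on
      (p := fun x => ∑ a, ∑ b, (μ⟦Astar ⁻¹' {b} | F⟧) ω * ∑ i ∈ S a ∩ S b,
        (x.1 i * (μ[(Astar ⁻¹' {a}).indicator (θ i) | F]) ω -
          x.2 i * (μ⟦Astar ⁻¹' {a} | F⟧) ω) + 1 -
      ∑ a, (μ⟦Astar ⁻¹' {a} | F⟧) ω * ∑ b, (μ⟦Astar ⁻¹' {b} | F⟧) ω *
        Real.exp (∑ i ∈ S a ∩ S b, (x.1 i * (μ[θ i | F]) ω + x.1 i ^ 2 / 8 - x.2 i)) ≤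
      posteriorMutualInfo F μ Astar Z ω) (l, r) (isClosed_le (by fun_prop) continuous_const) hω
  have he : ∀ᵐ ω ∂μ, ∀ a i,
      |(μ[(Astar ⁻¹' {a}).indicator (θ i) | F]) ω| ≤ (μ⟦Astar ⁻¹' {a} | F⟧) ω := by
    refine ae_all_iff.2 fun a => ae_all_iff.2 fun i => ?_
    have i1 := (hθi i).indicator (hX a)
    have i2 : Integrable ((Astar ⁻¹' {a}).indicator (fun _ => (1 : ℝ))) μ :=
      (integrable_const _).indicator (hX a)
    have u1 := condExp_mono (m := F) i1 i2 (by
      filter_upwards [hθC i] with ω h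
      by_cases hm : ω ∈ Astar ⁻¹' {a}
      · simpa [hm] using (abs_le.1 h).2
      · simp [hm])
    have u2 := condExp_mono (m := F) i2.neg i1 (by
      filter_upwards [hθC i] with ω h
      by_cases hm : ω ∈ Astar ⁻¹' {a}
      · simpa [hm] using (abs_le.1 h).1
      · simp [hm])
    filter_upwards [u1, u2, condExp_neg (μ := μ)
      ((Astar ⁻¹' {a}).indicator (fun _ => (1 : ℝ))) F] with ω e1 e2 e3
    rw [e3] at e2
    exact abs_le.2 ⟨e2, e1⟩
  have hSi : ∀ b, Integrable (fun ω => ∑ i ∈ S b, θ i ω) μ := fun b =>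
    integrable_finsetSum _ fun i _ => hθi i
  have hr1 : ∀ᵐ ω ∂μ, (μ[fun ω => ∑ i ∈ S (Astar ω), θ i ω | F]) ω =
      ∑ i, ∑ a, if i ∈ S a then (μ[(Astar ⁻¹' {a}).indicator (θ i) | F]) ω else 0 := by
    have h := fun a => condExp_finsetSum (μ := μ)
      (fun i (_ : i ∈ S a) => (hθi i).indicator (hX a)) F
    filter_upwards [condExp_comp_eq_sum (F := F) (W := fun b ω => ∑ i ∈ S b, θ i ω) hX hSi,
      ae_all_iff.2 h] with ω e1 e2
    rw [e1, Finset.sum_comm]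
    refine Finset.sum_congr rfl fun a _ => ?_
    have e : (Astar ⁻¹' {a}).indicator (fun ω => ∑ i ∈ S a, θ i ω) =
        ∑ i ∈ S a, (Astar ⁻¹' {a}).indicator (θ i) := by
      ext ω
      by_cases hm : ω ∈ Astar ⁻¹' {a} <;> simp [hm, Finset.sum_apply]
    rw [e, e2 a, Finset.sum_apply]
    simp
  -- Here the action decouples from θ, and matching the law of A to that of A* gives p_i u_i for
  -- each item.
  have hr2 : ∀ᵐ ω ∂μ, (μ[fun ω => ∑ i ∈ S (A ω), θ i ω | F]) ω =
      ∑ i, (∑ a, if i ∈ S a then (μ⟦Astar ⁻¹' {a} | F⟧) ω else 0) * (μ[θ i | F]) ω := by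
    have h1 := condExp_comp_action (W := fun b ω => ∑ i ∈ S b, θ i ω) (C := Fintype.card ι)
      hFG hG hA hAG
      (fun b => Finset.stronglyMeasurable_fun_sum _ fun i hi => (hθG b i hi).stronglyMeasurable)
      (fun b => by
        filter_upwards [hbdd'] with ω h
        simpa using abs_sum_le_of_mem_Icc h (S b) 1 0)
    have h2 := fun a => condExp_finsetSum (μ := μ) (fun i (_ : i ∈ S a) => hθi i) F
    filter_upwards [h1, ae_all_iff.2 h2, ae_all_iff.2 hTS] with ω e1 e2 e3
    rw [e1]
    simp only [Finset.sum_mul]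
    rw [Finset.sum_comm]
    refine Finset.sum_congr rfl fun a _ => ?_
    have e : (fun ω => ∑ i ∈ S a, θ i ω) = ∑ i ∈ S a, θ i := by
      ext ω; rw [Finset.sum_apply]
    rw [e, e2 a, Finset.sum_apply, e3 a, Finset.mul_sum]
    simp [ite_mul]
  filter_upwards [htilt, he, hr1, hr2, sum_condProb_eq_one (μ := μ) hF hX,
    ae_all_iff.2 fun a => condProb_mem_Icc (μ := μ) (F := F) _ (hX a),
    condExp_sub (integrable_comp (W := fun b ω => ∑ i ∈ S b, θ i ω) hX hSi)
      (integrable_comp (W := fun b ω => ∑ i ∈ S b, θ i ω) hA hSi) F] with ω e1 e2 e3 e4 e5 e6 e7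
  have key := two_mul_sum_sq_le_of_forall_tilt S (fun a => (e6 a).1) e5 e2 e1
  have e8 : (μ[fun ω => ∑ i ∈ S (Astar ω), θ i ω - ∑ i ∈ S (A ω), θ i ω | F]) ω = _ := e7
  rw [e8, Pi.sub_apply, e3, e4, ← Finset.sum_sub_distrib]
  -- Cauchy–Schwarz over the items is what produces the dimension factor.
  refine (mul_le_mul_of_nonneg_left sq_sum_le_card_mul_sum_sq zero_le_two).trans ?_
  rw [Finset.card_univ, mul_left_comm]
  exact mul_le_mul_of_nonneg_left key (Nat.cast_nonneg _)

end OneStep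

/-! ### Filtration of the bandit model, telescoping information, and cumulative regret. -/

section History

theorem measurable_observation {Ω 𝒜 𝒴 : Type*} {m : MeasurableSpace Ω} [MeasurableSpace 𝒜]
    [MeasurableSpace 𝒴] [Countable 𝒜] [MeasurableSingletonClass 𝒜] {Y : ℕ → Ω → 𝒜 → 𝒴}
    {A : ℕ → Ω → 𝒜} {t : ℕ} (hA : Measurable (A t)) (hY : Measurable (Y t)) :
    Measurable (observation Y A t) := by
  have heval : Measurable (fun p : (𝒜 → 𝒴) × 𝒜 => p.1 p.2) :=
    measurable_from_prod_countable_left fun a => measurable_pi_apply a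
  exact hA.prodMk (heval.comp (hY.prodMk hA))

theorem history_succ {Ω 𝒜 𝒴 : Type*} [MeasurableSpace 𝒜] [MeasurableSpace 𝒴]
    (Y : ℕ → Ω → 𝒜 → 𝒴) (A : ℕ → Ω → 𝒜) (t : ℕ) :
    history Y A (t + 1) = history Y A t ⊔ MeasurableSpace.comap (observation Y A t) inferInstance := by
  refine le_antisymm (iSup_le fun s => ?_) (sup_le (iSup_le fun s => ?_) ?_)
  · rcases Nat.lt_succ_iff_lt_or_eq.1 s.2 with hs | hs
    · exact (le_iSup (fun r : Fin t =>
        MeasurableSpace.comap (observation Y A r) inferInstance) ⟨s, hs⟩).trans le_sup_left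
    · rw [hs]
      exact le_sup_right
  · exact le_iSup (fun r : Fin (t + 1) =>
      MeasurableSpace.comap (observation Y A r) inferInstance) s.castSucc
  · exact le_iSup (fun r : Fin (t + 1) =>
      MeasurableSpace.comap (observation Y A r) inferInstance) (Fin.last t)

/-- Everything that the external randomness of period `t` is independent of. -/
abbrev environment {Ω 𝒜 𝒴 𝒰 : Type*} [MeasurableSpace 𝒜] [MeasurableSpace 𝒴]
    (pstar : Ω → ProbabilityMeasure (𝒜 → 𝒴)) (Y : ℕ → Ω → 𝒜 → 𝒴) (U : ℕ → Ω → 𝒰) (t : ℕ) (ω : Ω) :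
    ({s : ℕ // s ≠ t} → 𝒰) × (ℕ → 𝒜 → 𝒴) × ProbabilityMeasure (𝒜 → 𝒴) :=
  ((fun s : {s : ℕ // s ≠ t} => U s ω), (fun s => Y s ω), pstar ω)

theorem measurable_outcome_environment {Ω 𝒜 𝒴 𝒰 : Type*} [MeasurableSpace 𝒜]
    [MeasurableSpace 𝒴] [MeasurableSpace 𝒰] {pstar : Ω → ProbabilityMeasure (𝒜 → 𝒴)}
    {Y : ℕ → Ω → 𝒜 → 𝒴} {U : ℕ → Ω → 𝒰} (s t : ℕ) :
    Measurable[MeasurableSpace.comap (environment pstar Y U t) inferInstance] (Y s) :=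
  (measurable_pi_apply s).comp
    (measurable_fst.comp (measurable_snd.comp (comap_measurable (environment pstar Y U t))))

variable {Ω 𝒜 𝒴 𝒰 : Type*} [mΩ : MeasurableSpace Ω] [MeasurableSpace 𝒜] [MeasurableSpace 𝒴]
  [MeasurableSpace 𝒰] [Fintype 𝒜] {μ : Measure Ω}
  {pstar : Ω → ProbabilityMeasure (𝒜 → 𝒴)} {Y : ℕ → Ω → 𝒜 → 𝒴} {R : 𝒴 → ℝ} {U : ℕ → Ω → 𝒰}
  {A : ℕ → Ω → 𝒜} {Astar : Ω → 𝒜}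

namespace IsBanditModel

theorem measurable_environment (h : IsBanditModel μ pstar Y R U A Astar) (t : ℕ) :
    Measurable (environment pstar Y U t) :=
  (measurable_pi_lambda (fun ω (s : {s : ℕ // s ≠ t}) => U s ω)
    fun s => h.measurable_noise s).prodMk ((measurable_pi_lambda _ h.measurable_outcome).prodMk h.measurable_pstar)

theorem measurable_optimal_environment (h : IsBanditModel μ pstar Y R U A Astar) (t : ℕ) :
    Measurable[MeasurableSpace.comap (environment pstar Y U t) inferInstance] Astar := by
  have hp : Measurable[MeasurableSpace.comap (environment pstar Y U t) inferInstance] pstar :=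
    measurable_snd.comp (measurable_snd.comp (comap_measurable (environment pstar Y U t)))
  exact h.measurable_optimal.mono hp.comap_le le_rfl

theorem measurable_optimalAction (h : IsBanditModel μ pstar Y R U A Astar) : Measurable Astar :=
  h.measurable_optimal.mono h.measurable_pstar.comap_le le_rfl

variable [MeasurableSingletonClass 𝒜]

/-- By strong induction, each action before t is a function of an earlier history and of some U_r
with r ≠ t, and the environment of period t contains those U_r and all outcomes. -/
theorem history_le_environment (h : IsBanditModel μ pstar Y R U A Astar) (t : ℕ) :
    ∀ s ≤ t, history Y A s ≤ MeasurableSpace.comap (environment pstar Y U t) inferInstance := by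
  intro s
  induction s using Nat.strong_induction_on with
  | _ s ih =>
    intro hst
    refine iSup_le fun r => ?_
    have hrt : (r : ℕ) ≠ t := (r.2.trans_le hst).ne
    have hU : Measurable[MeasurableSpace.comap (environment pstar Y U t) inferInstance] (U r) :=
      (measurable_pi_apply (⟨r, hrt⟩ : {s : ℕ // s ≠ t})).comp
        (measurable_fst.comp (comap_measurable (environment pstar Y U t)))
    have hA : Measurable[MeasurableSpace.comap (environment pstar Y U t) inferInstance] (A r) :=
      (h.measurable_action r).mono
        (sup_le (ih r r.2 (r.2.le.trans hst)) hU.comap_le) le_rfl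
    exact (measurable_observation hA (measurable_outcome_environment (r : ℕ) t)).comap_le

theorem history_le (h : IsBanditModel μ pstar Y R U A Astar) (t : ℕ) : history Y A t ≤ mΩ :=
  (h.history_le_environment t t le_rfl).trans (h.measurable_environment t).comap_le

theorem measurable_chosen (h : IsBanditModel μ pstar Y R U A Astar) (t : ℕ) : Measurable (A t) :=
  (h.measurable_action t).mono (sup_le (h.history_le t) (h.measurable_noise t).comap_le) le_rfl

theorem measurable_observation (h : IsBanditModel μ pstar Y R U A Astar) (t : ℕ) :
    Measurable (observation Y A t) :=
  Bandit.measurable_observation (h.measurable_chosen t) (h.measurable_outcome t)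

/-- Given the history, the action of period `t` is independent of the environment. -/
theorem condProb_action_environment [IsProbabilityMeasure μ]
    (h : IsBanditModel μ pstar Y R U A Astar) (t : ℕ) (b : 𝒜) :
    μ⟦A t ⁻¹' {b} | MeasurableSpace.comap (environment pstar Y U t) inferInstance⟧
      =ᵐ[μ] μ⟦A t ⁻¹' {b} | history Y A t⟧ :=
  condProb_eq_of_indep_noise (h.measurable_noise t) (h.history_le_environment t t le_rfl)
    (h.measurable_environment t).comap_le (h.indep_noise t)
    (h.measurable_action t (measurableSet_singleton b))

theorem integrable_posteriorMutualInfo [IsProbabilityMeasure μ]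
    (h : IsBanditModel μ pstar Y R U A Astar) (t : ℕ) :
    Integrable (posteriorMutualInfo (history Y A t) μ Astar (observation Y A t)) μ :=
  (integrable_posteriorEntropy (h.history_le t)
    fun a => h.measurable_optimalAction (measurableSet_singleton a)).sub integrable_condExp

/-- The total information gain about the optimal action is at most its entropy. -/
theorem sum_integral_posteriorMutualInfo_le [IsProbabilityMeasure μ]
    (h : IsBanditModel μ pstar Y R U A Astar) (T : ℕ) :
    ∑ t ∈ Finset.range T,
      ∫ ω, posteriorMutualInfo (history Y A t) μ Astar (observation Y A t) ω ∂μ ≤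
      entropy μ Astar := by
  have hX : ∀ a, MeasurableSet (Astar ⁻¹' {a}) := fun a =>
    h.measurable_optimalAction (measurableSet_singleton a)
  -- Joining the current observation to the history gives the next history, so each expected gain is
  -- a drop in expected posterior entropy.
  have hstep : ∀ t, ∫ ω, posteriorMutualInfo (history Y A t) μ Astar (observation Y A t) ω ∂μ =
      ∫ ω, posteriorEntropy (history Y A t) μ Astar ω ∂μ -
        ∫ ω, posteriorEntropy (history Y A (t + 1)) μ Astar ω ∂μ := by
    intro t
    simp only [posteriorMutualInfo, posteriorCondEntropy]
    rw [integral_sub (integrable_posteriorEntropy (h.history_le t) hX) integrable_condExp,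
      integral_condExp (h.history_le t), ← history_succ]
  have h0 : ∫ ω, posteriorEntropy (history Y A 0) μ Astar ω ∂μ = entropy μ Astar := by
    have hbot : history Y A 0 = ⊥ := iSup_of_empty _
    have hconst : posteriorEntropy (history Y A 0) μ Astar = fun _ => entropy μ Astar := by
      ext ω
      rw [hbot, posteriorEntropy, entropy]
      refine Finset.sum_congr rfl fun a _ => ?_
      rw [condExp_bot]
      simp [integral_indicator_const _ (hX a)]
    rw [hconst]
    simp
  have hT : 0 ≤ ∫ ω, posteriorEntropy (history Y A T) μ Astar ω ∂μ := by
    refine integral_nonneg_of_ae ?_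
    filter_upwards [posteriorEntropy_mem_Icc (μ := μ) (H := history Y A T) hX] with ω hω
    exact hω.1
  simp only [hstep]
  rw [Finset.sum_range_sub', h0]
  linarith

/-- If the squared expected regret of each period is at most `K` times its information gain, then
the total expected regret is at most `√(K H(A*) T)`. -/
theorem integral_regret_le [IsProbabilityMeasure μ] (h : IsBanditModel μ pstar Y R U A Astar)
    {K : ℝ} (hK : 0 ≤ K) (hint : ∀ t, Integrable (instantRegret Y R A Astar t) μ)
    (hratio : ∀ t, ∀ᵐ ω ∂μ, (μ[instantRegret Y R A Astar t | history Y A t]) ω ^ 2 ≤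
      K * posteriorMutualInfo (history Y A t) μ Astar (observation Y A t) ω) (T : ℕ) :
    ∫ ω, regret Y R A Astar T ω ∂μ ≤ Real.sqrt (K * entropy μ Astar * T) := by
  have hsq : ∀ t, (∫ ω, instantRegret Y R A Astar t ω ∂μ) ^ 2 ≤
      K * ∫ ω, posteriorMutualInfo (history Y A t) μ Astar (observation Y A t) ω ∂μ := by
    intro t
    set c := ∫ ω, instantRegret Y R A Astar t ω ∂μ with hc
    have hx : Integrable (μ[instantRegret Y R A Astar t | history Y A t]) μ := integrable_condExp
    -- Jensen's inequality for the square, via the tangent 2cx - c² ≤ x²; no integrability of the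
    -- square is needed.
    have hle : ∫ ω, (2 * c * (μ[instantRegret Y R A Astar t | history Y A t]) ω - c ^ 2) ∂μ ≤
        ∫ ω, K * posteriorMutualInfo (history Y A t) μ Astar (observation Y A t) ω ∂μ := by
      refine integral_mono_ae ((hx.const_mul _).sub (integrable_const _))
        ((h.integrable_posteriorMutualInfo t).const_mul K) ?_
      filter_upwards [hratio t] with ω hω
      have := sq_nonneg ((μ[instantRegret Y R A Astar t | history Y A t]) ω - c)
      linarith
    rw [integral_sub (hx.const_mul _) (integrable_const _), integral_const_mul,
      integral_condExp (h.history_le t), integral_const_mul, ← hc] at hle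
    simp only [integral_const, probReal_univ, one_smul] at hle
    linarith
  refine Real.le_sqrt_of_sq_le ?_
  have hsum : ∫ ω, regret Y R A Astar T ω ∂μ =
      ∑ t ∈ Finset.range T, ∫ ω, instantRegret Y R A Astar t ω ∂μ :=
    integral_finsetSum _ fun t _ => hint t
  rw [hsum]
  calc (∑ t ∈ Finset.range T, ∫ ω, instantRegret Y R A Astar t ω ∂μ) ^ 2
      ≤ T * ∑ t ∈ Finset.range T, (∫ ω, instantRegret Y R A Astar t ω ∂μ) ^ 2 := by
        simpa using sq_sum_le_card_mul_sum_sq (s := Finset.range T)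
          (f := fun t => ∫ ω, instantRegret Y R A Astar t ω ∂μ)
    _ ≤ T * (K * entropy μ Astar) := by
        refine mul_le_mul_of_nonneg_left ?_ (Nat.cast_nonneg _)
        refine (Finset.sum_le_sum fun t _ => hsq t).trans ?_
        rw [← Finset.mul_sum]
        exact mul_le_mul_of_nonneg_left (h.sum_integral_posteriorMutualInfo_le T) hK
    _ = K * entropy μ Astar * T := by ring

end IsBanditModel

end History

/-! ### Semi-bandit outcomes and rewards in terms of the items. -/

section Items

variable {d : ℕ}

/-- The value of item `i` in an outcome, zero if the item does not appear. -/
noncomputable def itemValue (i : Fin d) (y : ItemOutcome d) : ℝ :=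
  if h : i ∈ y.1 then y.2 ⟨i, h⟩ else 0

theorem measurable_itemValue (i : Fin d) : Measurable (itemValue i) := by
  intro s hs
  -- A set in the sigma type is measurable when its trace on each fibre is, so the item set may be
  -- held fixed.
  refine (MeasurableSpace.measurableSet_iInf).2 fun a => ?_
  have : Measurable (fun v : a → ℝ => itemValue i ⟨a, v⟩) := by
    by_cases h : i ∈ a
    · simpa [itemValue, h] using measurable_pi_apply (⟨i, h⟩ : a)
    · simp [itemValue, h]
  exact this hs

variable {Ω : Type*} {𝒜 : Finset (Finset (Fin d))} (θ : ℕ → Fin d → Ω → ℝ)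

theorem itemValue_itemOutcome (t : ℕ) (ω : Ω) (a : 𝒜) (i : Fin d) :
    itemValue i (itemOutcome θ t ω a) = if i ∈ a.1 then θ t i ω else 0 := by
  by_cases h : i ∈ a.1 <;> simp [itemValue, itemOutcome, h]

theorem itemReward_itemOutcome (m t : ℕ) (ω : Ω) (a : 𝒜) :
    itemReward m (itemOutcome θ t ω a) = (1 / (m : ℝ)) * ∑ i ∈ a.1, θ t i ω := by
  rw [itemReward, itemOutcome, ← Finset.sum_coe_sort a.1 fun i => θ t i ω]

theorem instantRegret_itemOutcome (m t : ℕ) (A : ℕ → Ω → 𝒜) (Astar : Ω → 𝒜) :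
    instantRegret (itemOutcome θ) (itemReward m) A Astar t = (1 / (m : ℝ)) • fun ω =>
      ∑ i ∈ (Astar ω).1, θ t i ω - ∑ i ∈ (A t ω).1, θ t i ω := by
  ext ω
  simp only [instantRegret, itemReward_itemOutcome, Pi.smul_apply, smul_eq_mul]
  ring

end Items

end Bandit

/-! ### The semi-bandit bounds. -/

theorem proposition6 {Ω 𝒰 : Type*} [MeasurableSpace Ω] [MeasurableSpace 𝒰]
    (μ : Measure Ω) [IsProbabilityMeasure μ]
    (d m : ℕ) (hm : 1 ≤ m)
    (𝒜 : Finset (Finset (Fin d))) (h𝒜 : ∀ a ∈ 𝒜, a.card ≤ m)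
    (θ : ℕ → Fin d → Ω → ℝ) (hθ : ∀ t i, Measurable (θ t i))
    (hθ_bdd : ∀ t i, ∀ᵐ ω ∂μ, θ t i ω ∈ Set.Icc (-1 / 2 : ℝ) (1 / 2))
    (pstar : Ω → ProbabilityMeasure (𝒜 → ItemOutcome d))
    (U : ℕ → Ω → 𝒰) (A : ℕ → Ω → 𝒜) (Astar : Ω → 𝒜)
    (hmodel : IsBanditModel μ pstar (itemOutcome θ) (itemReward m) U A Astar)
    (hTS : IsThompsonSampling μ (itemOutcome θ) A Astar)
    (hindep : ∀ t, CondIndepGiven (history (itemOutcome θ) A t) μ (θ t)) :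
    (∀ t, ∀ᵐ ω ∂μ, informationRatio μ (itemOutcome θ) (itemReward m) A Astar t ω
        ≤ ENNReal.ofReal ((d : ℝ) / (2 * (m : ℝ) ^ 2))) ∧
    (∀ T : ℕ, ∫ ω, regret (itemOutcome θ) (itemReward m) A Astar T ω ∂μ
        ≤ (1 / (m : ℝ)) * Real.sqrt ((d : ℝ) * entropy μ Astar * (T : ℝ))) := by
  have hm0 : (0 : ℝ) < m := by exact_mod_cast hm
  have hK : (0 : ℝ) ≤ (d : ℝ) / (2 * (m : ℝ) ^ 2) := by positivity
  have hratio : ∀ t, ∀ᵐ ω ∂μ, (μ[instantRegret (itemOutcome θ) (itemReward m) A Astar t |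
      history (itemOutcome θ) A t]) ω ^ 2 ≤ (d : ℝ) / (2 * (m : ℝ) ^ 2) *
      posteriorMutualInfo (history (itemOutcome θ) A t) μ Astar
        (observation (itemOutcome θ) A t) ω := by
    intro t
    have hobs : Measurable[MeasurableSpace.comap (observation (itemOutcome θ) A t) inferInstance]
        (observation (itemOutcome θ) A t) := comap_measurable _
    have key := sq_condExp_regret_le (S := fun a : 𝒜 => a.1) (θ := θ t)
      (hmodel.history_le_environment t t le_rfl) (hmodel.measurable_environment t).comap_le
      (hmodel.measurable_observation t) (hθ t) (hθ_bdd t) (hindep t)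
      (fun b => hmodel.measurable_chosen t (measurableSet_singleton b))
      (hmodel.condProb_action_environment t) (hTS t)
      (fun b => hmodel.measurable_optimal_environment t (measurableSet_singleton b))
      (fun b i hi => by
        have h1 := (measurable_itemValue i).comp ((measurable_pi_apply b).comp
          (measurable_outcome_environment (pstar := pstar) (Y := itemOutcome θ)
            (U := U) t t))
        convert h1 using 1
        ext ω
        simp [itemValue_itemOutcome, hi])
      (fun b => (measurable_fst.comp hobs) (measurableSet_singleton b))
      (fun i => by
        have h1 := (measurable_itemValue i).comp (measurable_snd.comp hobs)
        convert h1 using 1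
        ext ω
        simp [observation, itemValue_itemOutcome])
    rw [instantRegret_itemOutcome]
    filter_upwards [key, condExp_smul (μ := μ) (1 / (m : ℝ))
      (fun ω => ∑ i ∈ (Astar ω).1, θ t i ω - ∑ i ∈ (A t ω).1, θ t i ω)
      (history (itemOutcome θ) A t)] with ω h1 h2
    rw [Fintype.card_fin] at h1
    rw [h2, Pi.smul_apply, smul_eq_mul, mul_pow, div_mul_eq_mul_div,
      le_div_iff₀ (by positivity)]
    refine le_trans (le_of_eq ?_) h1
    field_simp
  have hint : ∀ t, Integrable (instantRegret (itemOutcome θ) (itemReward m) A Astar t) μ := by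
    intro t
    have hθi : ∀ i, Integrable (θ t i) μ := by
      intro i
      refine integrable_of_ae_abs_le (C := 1) (hθ t i).aestronglyMeasurable ?_
      filter_upwards [hθ_bdd t i] with ω h
      exact abs_le.2 ⟨by linarith [h.1], by linarith [h.2]⟩
    have hS : ∀ b : 𝒜, Integrable (fun ω => ∑ i ∈ b.1, θ t i ω) μ := fun b =>
      integrable_finsetSum _ fun i _ => hθi i
    rw [instantRegret_itemOutcome]
    exact ((integrable_comp (fun b => hmodel.measurable_optimalAction (measurableSet_singleton b)) hS).sub
      (integrable_comp (fun b => hmodel.measurable_chosen t (measurableSet_singleton b)) hS)).smul _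
  refine ⟨fun t => ?_, fun T => ?_⟩
  · filter_upwards [hratio t] with ω hω
    -- The product form of the inequality also covers zero information gain: it forces the squared
    -- regret to vanish, and 0/0 = 0.
    refine ENNReal.div_le_of_le_mul ?_
    rw [← ENNReal.ofReal_mul hK]
    exact ENNReal.ofReal_le_ofReal hω
  · refine (hmodel.integral_regret_le hK hint hratio T).trans ?_
    have hH : 0 ≤ entropy μ Astar := Finset.sum_nonneg fun a _ =>
      Real.negMulLog_nonneg measureReal_nonneg measureReal_le_one
    rw [← Real.sqrt_sq (by positivity : (0 : ℝ) ≤ 1 / (m : ℝ)), ← Real.sqrt_mul (sq_nonneg _)]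
    refine Real.sqrt_le_sqrt ?_
    have h1 : (d : ℝ) / (2 * (m : ℝ) ^ 2) * entropy μ Astar * T =
        ((1 / (m : ℝ)) ^ 2 * (d * entropy μ Astar * T)) / 2 := by
      field_simp
    rw [h1]
    -- The ratio bound yields a regret bound smaller by a factor √2; the spare 1/2 under the root is
    -- dropped here.
    exact half_le_self (by positivity)
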